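/- Let $\mathcal O$ be a complete discrete valuation ring with uniformizer $\pi$ and finite residue field $k$ of cardinality $q$. For an $\mathcal O$-algebra $B$ let $W_{\mathcal O}(B)$ denote the ring of ramified Witt vectors: as a set $W_{\mathcal O}(B)=B^{\mathbb N_0}$, with the unique functorial $\mathcal O$-algebra structure for which all the maps $$\Phi_n\colon W_{\mathcal O}(B)\to B,\qquad \Phi_n(b_0,b_1,\dots)=\sum_{i=0}^n\pi^i b_i^{q^{n-i}}\qquad(n\ge 0)$$ are homomorphisms of $\mathcal O$-algebras. The functor $W_{\mathcal O}$ is represented by a ring scheme $\mathbb W_{\mathcal O}=\mathrm{Spec}\,\mathcal O[X_0,X_1,\dots]$. Let $\mathcal O'/\mathcal O$ be a finite totally ramified extension of discrete valuation rings (i.e. the residue field extension is trivial) of degree $e$, and let $\varpi$ be a uniformizer of $\mathcal O'$. Define $W_{\mathcal O'}$, $\Phi'_n$ and $\mathbb W_{\mathcal O'}$ in the same way from $\mathcal O'$ and $\varpi$. For $\mathcal O'$-algebras $B$, let $u_B\colon W_{\mathcal O}(B)\to W_{\mathcal O'}(B)$ be Drinfeld's homomorphism, i.e. the unique functorial homomorphism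 of $\mathcal O$-algebras with $\Phi'_n(u_B(b))=\Phi_n(b)$ for all $n\ge 0$, and let $$u^{\rm ra}_B=u_B\otimes\mathrm{id}\colon W_{\mathcal O}(B)\otimes_{\mathcal O}\mathcal O'\to W_{\mathcal O'}(B),\qquad \sum_{i=0}^{e-1}b_i\otimes\varpi^i\mapsto\sum_{i=0}^{e-1}u_B(b_i)\,\varpi^i .$$ Since $\mathcal O'=\bigoplus_{i=0}^{e-1}\mathcal O\varpi^i$, the functor $B\mapsto W_{\mathcal O}(B)\otimes_{\mathcal O}\mathcal O'$ on $k$-algebras is represented by a ring scheme $\prod^{\varpi}\mathbb W_{\mathcal O,k}=\mathrm{Spec}\,k[X_{n,i};\,n\in\mathbb N_0,\,0\le i<e]$, where $X_{n,i}$ is the $n$-th Witt component of $b_i$ in $\sum_i b_i\otimes\varpi^i$; let $\mathbb W_{\mathcal O',k}$ be the special fibre of $\mathbb W_{\mathcal O'}$. The homomorphisms $u^{\rm ra}_B$, for $k$-algebras $B$, define a morphism of ring schemes $$\boldsymbol u^{\rm ra}_k\colon \prod^{\varpi}\mathbb W_{\mathcal O,k}\to\mathbb W_{\mathcal O',k}.$$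 Then $\boldsymbol u^{\rm ra}_k$ is a universal homeomorphism. Its kernel, as a homomorphism of additive group schemes over $k$, is pro-infinitesimal (a cofiltered limit of finite $k$-group schemes having only one point) and is isomorphic, as a $k$-scheme, to $$\mathrm{Spec}\Big(k[X_{n,i};\,n\in\mathbb N_0,\,0\le i<e]\,/\,\big(X_{n,i}^{\,q^{n(e-1)+i}};\,n\in\mathbb N_0,\,0\le i<e\big)\Big).$$ -/

import Mathlib

namespace RamWitt

open MvPolynomial IsLocalRing

section Dwork

variable {A : Type*} [CommRing A]

lemma dvd_pow_sub_pow {ϖ a b : A} {q : ℕ} (hq : ϖ ∣ (q : A)) {m : ℕ}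
    (h : ϖ ^ (m + 1) ∣ a - b) (s : ℕ) : ϖ ^ (m + 1 + s) ∣ a ^ q ^ s - b ^ q ^ s := by
  induction s with
  | zero => simpa using h
  | succ s ih =>
    obtain ⟨c, hc⟩ := ih
    obtain ⟨d, hd⟩ := hq
    have ha : a ^ q ^ s = b ^ q ^ s + ϖ ^ (m + 1 + s) * c := by rw [← hc]; ring
    rw [pow_succ q s, pow_mul, pow_mul, ha]
    obtain ⟨k, hk⟩ := Polynomial.powAddExpansion (b ^ q ^ s) (ϖ ^ (m + 1 + s) * c) q
    rw [hk, hd]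
    exact ⟨d * (b ^ q ^ s) ^ (q - 1) * c + k * ϖ ^ (m + s) * c ^ 2, by ring⟩

/-- The solution `b`, constructed recursively, of the system of equations
`∑_{i ≤ n} ϖ ^ i * b i ^ q ^ (n - i) = a n`; see `dworkSol_spec` and `ghost_unique` for existence
and uniqueness in the cases in which it is used. -/
noncomputable def dworkSol (ϖ : A) (q : ℕ) (a : ℕ → A) (n : ℕ) : A :=
  Classical.epsilon fun c =>
    ϖ ^ n * c = a n - ∑ i : Fin n, ϖ ^ (i : ℕ) * dworkSol ϖ q a i ^ q ^ (n - i)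
termination_by n
decreasing_by exact i.2

theorem dworkSol_spec (ϖ : A) (q : ℕ) (hq : ϖ ∣ (q : A)) (σ : A →+* A)
    (hσϖ : σ ϖ = ϖ) (hσ : ∀ x, ϖ ∣ σ x - x ^ q) (a : ℕ → A)
    (ha : ∀ n, ϖ ^ (n + 1) ∣ σ (a n) - a (n + 1)) (n : ℕ) :
    ∑ i ∈ Finset.range (n + 1), ϖ ^ i * dworkSol ϖ q a i ^ q ^ (n - i) = a n := by
  have key : ∀ n, (∃ c, ϖ ^ n * c =
      a n - ∑ i : Fin n, ϖ ^ (i : ℕ) * dworkSol ϖ q a i ^ q ^ (n - i)) →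
      ∑ i ∈ Finset.range (n + 1), ϖ ^ i * dworkSol ϖ q a i ^ q ^ (n - i) = a n := by
    intro n hn
    have := Classical.epsilon_spec hn
    rw [← dworkSol] at this
    rw [Finset.sum_range_succ, Nat.sub_self, pow_zero, pow_one, this,
      Fin.sum_univ_eq_sum_range (fun i => ϖ ^ i * dworkSol ϖ q a i ^ q ^ (n - i)) n]
    ring
  induction n with
  | zero => exact key 0 ⟨a 0, by simp⟩
  | succ n ih =>
    apply key
    rw [Fin.sum_univ_eq_sum_range (fun i => ϖ ^ i * dworkSol ϖ q a i ^ q ^ (n + 1 - i)) (n + 1)]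
    have h1 : ϖ ^ (n + 1) ∣ σ (a n) -
        ∑ i ∈ Finset.range (n + 1), ϖ ^ i * dworkSol ϖ q a i ^ q ^ (n + 1 - i) := by
      rw [← ih, map_sum, ← Finset.sum_sub_distrib]
      refine Finset.dvd_sum fun i hi => ?_
      have hi : i ≤ n := Nat.lt_succ_iff.1 (Finset.mem_range.1 hi)
      have h := dvd_pow_sub_pow hq (m := 0) (by simpa using hσ (dworkSol ϖ q a i)) (n - i)
      rw [map_mul, map_pow, map_pow, hσϖ, ← mul_sub, Nat.succ_sub hi, pow_succ' q, pow_mul]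
      refine dvd_trans ?_ (mul_dvd_mul_left (ϖ ^ i) h)
      rw [← pow_add]
      exact pow_dvd_pow _ (by omega)
    obtain ⟨c, hc⟩ := dvd_sub h1 (ha n)
    exact ⟨c, by rw [← hc]; ring⟩

theorem ghost_unique {ϖ : A} (hϖ : IsLeftRegular ϖ) (q : ℕ) (b c : ℕ → A)
    (h : ∀ n, ∑ i ∈ Finset.range (n + 1), ϖ ^ i * b i ^ q ^ (n - i) =
      ∑ i ∈ Finset.range (n + 1), ϖ ^ i * c i ^ q ^ (n - i)) : b = c := by
  funext n
  induction n using Nat.strong_induction_on with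
  | _ n ih =>
    have hn := h n
    rw [Finset.sum_range_succ, Finset.sum_range_succ,
      Finset.sum_congr rfl fun i hi => by rw [ih i (Finset.mem_range.1 hi)]] at hn
    simpa using (hϖ.pow n) (by simpa using hn)

end Dwork

section Uniformizer

variable (O : Type*) [CommRing O] [IsDomain O] [IsDiscreteValuationRing O]

/-- A uniformizing parameter of a discrete valuation ring. -/
abbrev Uniformizer := {π : O // Irreducible π}

/-- The cardinality `q` of the (finite) residue field. -/
noncomputable abbrev residueCard : ℕ := Nat.card (ResidueField O)

variable {O}

lemma Uniformizer.dvd_iff (π : Uniformizer O) (x : O) : π.1 ∣ x ↔ residue O x = 0 := by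
  rw [residue_eq_zero_iff, π.2.maximalIdeal_eq, Ideal.mem_span_singleton]

lemma Uniformizer.dvd_residueCard [Finite (ResidueField O)] (π : Uniformizer O) :
    π.1 ∣ (residueCard O : O) := by
  rw [π.dvd_iff, map_natCast]
  cases nonempty_fintype (ResidueField O)
  rw [residueCard, Nat.card_eq_fintype_card, Nat.cast_card_eq_zero]

lemma expand_card {k τ : Type*} [Field k] [Finite k] (f : MvPolynomial τ k) :
    expand (Nat.card k) f = f ^ Nat.card k := by
  cases nonempty_fintype k
  obtain ⟨p, hp, n, hpp, hn⟩ := FiniteField.card' k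
  have : Fact p.Prime := ⟨hpp⟩
  rw [Nat.card_eq_fintype_card]
  induction f using MvPolynomial.induction_on with
  | C a => rw [expand_C, ← C_pow, FiniteField.pow_card]
  | add f g hf hg => rw [map_add, hf, hg, hn, add_pow_char_pow]
  | mul_X f i hf => rw [map_mul, hf, expand_X, mul_pow]

lemma Uniformizer.dvd_expand_sub_pow [Finite (ResidueField O)] (π : Uniformizer O) {τ : Type*}
    (f : MvPolynomial τ O) : C π.1 ∣ expand (residueCard O) f - f ^ residueCard O := by
  rw [C_dvd_iff_map_hom_eq_zero (residue O) _ fun r => (π.dvd_iff r).symm, map_sub, map_expand,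
    expand_card, map_pow, sub_self]

/-- The Witt polynomial `Φ_n = ∑_{i ≤ n} π ^ i X_i ^ (q ^ (n - i))`. -/
noncomputable def wittPhi (π : Uniformizer O) (n : ℕ) : MvPolynomial ℕ O :=
  ∑ i ∈ Finset.range (n + 1), C (π.1 ^ i) * X i ^ residueCard O ^ (n - i)

lemma aeval_wittPhi {B : Type*} [CommRing B] [Algebra O B] (π : Uniformizer O) (b : ℕ → B) (n : ℕ) :
    aeval b (wittPhi π n) = ∑ i ∈ Finset.range (n + 1),
      algebraMap O B π.1 ^ i * b i ^ residueCard O ^ (n - i) := by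
  simp [wittPhi, map_sum]

lemma ghost_injective {B : Type*} [CommRing B] [Algebra O B] (π : Uniformizer O)
    (hπ : IsLeftRegular (algebraMap O B π.1)) {b c : ℕ → B}
    (h : ∀ n, aeval b (wittPhi π n) = aeval c (wittPhi π n)) : b = c :=
  ghost_unique hπ (residueCard O) b c fun n => by simpa only [aeval_wittPhi] using h n

variable [Finite (ResidueField O)]

theorem exists_ghost (π : Uniformizer O) {τ : Type*} (a : ℕ → MvPolynomial τ O)
    (ha : ∀ n, C π.1 ^ (n + 1) ∣ expand (residueCard O) (a n) - a (n + 1)) (n : ℕ) :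
    aeval (dworkSol (C π.1) (residueCard O) a) (wittPhi π n) = a n := by
  rw [aeval_wittPhi, algebraMap_eq]
  exact dworkSol_spec (C π.1) (residueCard O)
    (by simpa using map_dvd (C (σ := τ)) π.dvd_residueCard)
    (expand (residueCard O)).toRingHom (by simp) (fun x => π.dvd_expand_sub_pow x) a ha n

lemma wittPhi_succ_dvd (π : Uniformizer O) (n : ℕ) :
    C π.1 ^ (n + 1) ∣ expand (residueCard O) (wittPhi π n) - wittPhi π (n + 1) := by
  refine ⟨- X (n + 1), ?_⟩
  rw [wittPhi, wittPhi, Finset.sum_range_succ (n := n + 1), map_sum, ← sub_sub,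
    ← Finset.sum_sub_distrib, Finset.sum_eq_zero]
  · simp
  intro i hi
  have hi : i ≤ n := Nat.lt_succ_iff.1 (Finset.mem_range.1 hi)
  rw [map_mul, map_pow _ (X i), expand_X, expand_C, Nat.succ_sub hi, pow_succ' (residueCard O), pow_mul, sub_self]

/-- The polynomials giving the Witt components of the operation on ramified Witt vectors which is
given on ghost components by the polynomial `f`: they are characterised by `aeval_opPoly`. -/
noncomputable def opPoly (π : Uniformizer O) {ι : Type*} (f : MvPolynomial ι O) :
    ℕ → MvPolynomial (ι × ℕ) O :=
  dworkSol (C π.1) (residueCard O)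
    fun n => bind₁ (fun i => rename (Prod.mk i) (wittPhi π n)) f

lemma aeval_opPoly (π : Uniformizer O) {ι : Type*} (f : MvPolynomial ι O) (n : ℕ) :
    aeval (opPoly π f) (wittPhi π n) = bind₁ (fun i => rename (Prod.mk i) (wittPhi π n)) f := by
  refine exists_ghost π _ (fun n => ?_) n
  have h : ∀ (S : Ideal (MvPolynomial (ι × ℕ) O)) (u v : ι → MvPolynomial (ι × ℕ) O),
      (∀ i, u i - v i ∈ S) → bind₁ u f - bind₁ v f ∈ S := by
    intro S u v h
    rw [← Ideal.Quotient.mk_eq_mk_iff_sub_mem]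
    rw [← Ideal.Quotient.mkₐ_eq_mk O, ← AlgHom.comp_apply, ← AlgHom.comp_apply]
    congr 1
    ext i
    simpa [Ideal.Quotient.mk_eq_mk_iff_sub_mem] using h i
  rw [← Ideal.mem_span_singleton]
  rw [expand_bind₁]
  refine h _ _ _ fun i => ?_
  rw [Ideal.mem_span_singleton, ← rename_expand, ← map_sub]
  simpa using map_dvd (rename (R := O) (Prod.mk i)) (wittPhi_succ_dvd π n)

end Uniformizer

section Extension

open scoped TensorProduct

variable {O O' : Type*} [CommRing O] [IsDomain O] [IsDiscreteValuationRing O]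
  [CommRing O'] [IsDomain O'] [IsDiscreteValuationRing O']
  [Algebra O O'] [IsLocalHom (algebraMap O O')]

variable (O O') in
/-- The residue degree `r` of `O' / O`. -/
noncomputable abbrev residueDegree : ℕ := Module.finrank (ResidueField O) (ResidueField O')

variable (O O') in
/-- A finite extension of discrete valuation rings is totally ramified if the extension of residue
fields is trivial. -/
def IsTotallyRamified : Prop :=
  Function.Bijective (algebraMap (ResidueField O) (ResidueField O'))

theorem IsTotallyRamified.top_le_span [Module.Finite O O'] [FaithfulSMul O O']
    (h : IsTotallyRamified O O') {ϖ : O'} (hϖ : Irreducible ϖ) {e : ℕ}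
    (he : Module.finrank O O' = e) :
    ⊤ ≤ Submodule.span O (Set.range fun i : Fin e => ϖ ^ (i : ℕ)) := by
  have hm : (maximalIdeal O).map (algebraMap O O') ≠ ⊥ := by
    rw [Ne, Ideal.map_eq_bot_iff_of_injective (FaithfulSMul.algebraMap_injective O O')]
    exact IsDiscreteValuationRing.not_a_field O
  have : Module.IsTorsionFree O O' := inferInstance
  have : Fintype ((maximalIdeal O).primesOver O') := by
    have : Finite ((maximalIdeal O).primesOver O') := inferInstance
    exact Fintype.ofFinite _
  have hle : (maximalIdeal O').ramificationIdx O ≤ e := by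
    rw [← he, ← Ideal.sum_ramification_inertia_eq_finrank (maximalIdeal O) O']
    refine le_trans (Nat.le_mul_of_pos_right _ (Ideal.inertiaDeg_pos (maximalIdeal O') O))
      (Finset.single_le_sum (f := fun q : (maximalIdeal O).primesOver O' =>
        q.1.ramificationIdx O * q.1.inertiaDeg O) (fun _ _ => Nat.zero_le _)
        (Finset.mem_univ ⟨maximalIdeal O', inferInstance, inferInstance⟩))
  obtain ⟨m, hm'⟩ := IsDiscreteValuationRing.ideal_eq_span_pow_irreducible hm hϖ
  have hme : m ≤ e := by
    refine le_trans (le_of_eq ?_) hle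
    rw [Ideal.IsDedekindDomain.ramificationIdx_eq_multiplicity (maximalIdeal O) _ hm, hm', ← Ideal.span_singleton_pow, ← hϖ.maximalIdeal_eq]
    symm
    refine multiplicity_pow_self ?_ ?_ _
    · exact IsDiscreteValuationRing.not_a_field O'
    · exact fun hu => (maximalIdeal.isMaximal O').ne_top (Ideal.isUnit_iff.1 hu)
  have key : ∀ j, ∀ x : O', ∃ y ∈ Submodule.span O (Set.range fun i : Fin j => ϖ ^ (i : ℕ)),
      ϖ ^ j ∣ x - y := by
    intro j
    induction j with
    | zero => exact fun x => ⟨0, zero_mem _, by simp⟩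
    | succ j ih =>
      intro x
      obtain ⟨y, hy, c, hc⟩ := ih x
      obtain ⟨a, ha⟩ := h.2 (residue O' c)
      obtain ⟨a, rfl⟩ := residue_surjective a
      rw [ResidueField.algebraMap_residue, eq_comm, ← sub_eq_zero, ← map_sub, residue_eq_zero_iff,
        hϖ.maximalIdeal_eq, Ideal.mem_span_singleton] at ha
      obtain ⟨d, hd⟩ := ha
      refine ⟨y + a • ϖ ^ j, add_mem (Submodule.span_mono ?_ hy)
        (Submodule.smul_mem _ _ (Submodule.subset_span ⟨Fin.last j, by simp⟩)), d, ?_⟩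
      · rintro _ ⟨i, rfl⟩
        exact ⟨i.castSucc, rfl⟩
      · rw [← sub_sub, hc, Algebra.smul_def, pow_succ, mul_assoc, ← hd]
        ring
  refine Submodule.le_of_le_smul_of_le_jacobson_bot (I := maximalIdeal O) Module.Finite.fg_top
    (maximalIdeal_le_jacobson _) fun x _ => ?_
  obtain ⟨y, hy, hxy⟩ := key e x
  rw [← sub_add_cancel x y, add_comm]
  refine Submodule.add_mem_sup hy ?_
  rw [Ideal.smul_top_eq_map, Submodule.restrictScalars_mem, hm', Ideal.mem_span_singleton]
  exact (pow_dvd_pow ϖ hme).trans hxy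

/-- The basis `1, ϖ, …, ϖ ^ (e - 1)` of `O'` over `O`. -/
noncomputable def IsTotallyRamified.basis [Module.Finite O O'] [FaithfulSMul O O']
    (h : IsTotallyRamified O O') {ϖ : O'} (hϖ : Irreducible ϖ) {e : ℕ}
    (he : Module.finrank O O' = e) : Module.Basis (Fin e) O O' :=
  basisOfTopLeSpanOfCardEqFinrank (fun i : Fin e => ϖ ^ (i : ℕ)) (h.top_le_span hϖ he) (by simp [he])

theorem IsTotallyRamified.sum_tmul_bijective [Module.Finite O O'] [FaithfulSMul O O']
    (h : IsTotallyRamified O O') {ϖ : O'} (hϖ : Irreducible ϖ) {e : ℕ}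
    (he : Module.finrank O O' = e) (M : Type*) [AddCommGroup M] [Module O M] :
    Function.Bijective fun b : Fin e → M => ∑ i, b i ⊗ₜ[O] (ϖ ^ (i : ℕ)) := by
  convert (Finsupp.equivFunOnFinite.symm.trans
    (TensorProduct.equivFinsuppOfBasisRight (M := M) (h.basis hϖ he)).symm.toEquiv).bijective using 1
  funext b
  simp [IsTotallyRamified.basis, Finsupp.sum_fintype]

end Extension

end RamWitt

/-- The ramified Witt vectors `W_O(B)` with components in the `O`-algebra `B`, relative to the
uniformizer `π` of `O`. As a set this is `B ^ ℕ`; the `O`-algebra structure is the functorial one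
for which the ghost components `Φ_n` are homomorphisms of `O`-algebras (see `ghostHom`, `map`). -/
@[ext]
structure RamifiedWitt {O : Type*} [CommRing O] [IsDomain O] [IsDiscreteValuationRing O]
    (π : RamWitt.Uniformizer O) (B : Type*) where
  /-- The components `b_0, b_1, …`. -/
  coeff : ℕ → B

namespace RamifiedWitt

open RamWitt MvPolynomial IsLocalRing

variable {O : Type*} [CommRing O] [IsDomain O] [IsDiscreteValuationRing O]
  {π : Uniformizer O} {A B : Type*} [CommRing A] [CommRing B] [Algebra O A] [Algebra O B]
  {ι κ : Type*}

/-- The ghost component `Φ_n(b)`. -/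
noncomputable def ghost (n : ℕ) (b : RamifiedWitt π B) : B := aeval b.coeff (wittPhi π n)

lemma ghost_ext (hπ : IsLeftRegular (algebraMap O B π.1)) {b c : RamifiedWitt π B}
    (h : ∀ n, b.ghost n = c.ghost n) : b = c :=
  RamifiedWitt.ext (ghost_injective π hπ h)

/-- The map on ramified Witt vectors induced by a homomorphism of `O`-algebras. -/
def mapFun (φ : A → B) (b : RamifiedWitt π A) : RamifiedWitt π B := ⟨fun n => φ (b.coeff n)⟩

/-- The universal family of ramified Witt vectors indexed by `ι`. -/
noncomputable def univ (π : Uniformizer O) (R : Type*) [CommRing R] (ι : Type*) (i : ι) :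
    RamifiedWitt π (MvPolynomial (ι × ℕ) R) := ⟨fun n => X (i, n)⟩

lemma mapFun_univ {R : Type*} [CommRing R] [Algebra R B] (v : ι → RamifiedWitt π B) (i : ι) :
    mapFun (aeval fun p : ι × ℕ => (v p.1).coeff p.2) (univ π R ι i) = v i := by
  ext n; simp [mapFun, univ]

variable [Finite (ResidueField O)]

/-- The operation on ramified Witt vectors given on ghost components by the polynomial `f`
(see `ghost_op`). -/
noncomputable def polyOp (f : MvPolynomial ι O) (v : ι → RamifiedWitt π B) : RamifiedWitt π B :=
  ⟨fun n => aeval (fun p : ι × ℕ => (v p.1).coeff p.2) (opPoly π f n)⟩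

lemma ghost_op (f : MvPolynomial ι O) (v : ι → RamifiedWitt π B) (n : ℕ) :
    (polyOp f v).ghost n = aeval (fun i => (v i).ghost n) f := by
  have h := congrArg (aeval fun p : ι × ℕ => (v p.1).coeff p.2) (aeval_opPoly π f n)
  rw [comp_aeval_apply, aeval_bind₁] at h
  simpa [ghost, polyOp, aeval_rename, Function.comp_def] using h

lemma map_op (φ : A →ₐ[O] B) (f : MvPolynomial ι O) (v : ι → RamifiedWitt π A) :
    mapFun φ (polyOp f v) = polyOp f fun i => mapFun φ (v i) := by
  ext n
  simp [mapFun, polyOp, comp_aeval_apply]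

lemma isLeftRegular_algebraMap {τ R : Type*} [CommRing R] [IsDomain R] [Algebra O R]
    [FaithfulSMul O R] : IsLeftRegular (algebraMap O (MvPolynomial τ R) π.1) := by
  refine IsLeftCancelMulZero.mul_left_cancel_of_ne_zero ?_
  rw [MvPolynomial.algebraMap_apply, Ne, C_eq_zero,
    FaithfulSMul.algebraMap_eq_zero_iff]
  exact π.2.ne_zero

lemma op_op (f : MvPolynomial ι O) (g : ι → MvPolynomial κ O) (v : κ → RamifiedWitt π B) :
    polyOp f (fun i => polyOp (g i) v) = polyOp (bind₁ g f) v := by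
  have h : polyOp f (fun i => polyOp (g i) (univ π O κ)) = polyOp (bind₁ g f) (univ π O κ) :=
    ghost_ext isLeftRegular_algebraMap fun n => by
      simp only [ghost_op, aeval_bind₁]
  have := congrArg (mapFun (aeval fun p : κ × ℕ => (v p.1).coeff p.2)) h
  simpa only [map_op, mapFun_univ] using this

lemma op_X (i : ι) (v : ι → RamifiedWitt π B) : polyOp (X i) v = v i := by
  have h : polyOp (X i) (univ π O ι) = univ π O ι i :=
    ghost_ext isLeftRegular_algebraMap fun n => by simp only [ghost_op, aeval_X]
  have := congrArg (mapFun (aeval fun p : ι × ℕ => (v p.1).coeff p.2)) h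
  simpa only [map_op, mapFun_univ] using this

noncomputable instance : Add (RamifiedWitt π B) := ⟨fun a b => polyOp (X 0 + X 1) ![a, b]⟩
noncomputable instance : Mul (RamifiedWitt π B) := ⟨fun a b => polyOp (X 0 * X 1) ![a, b]⟩
noncomputable instance : Neg (RamifiedWitt π B) := ⟨fun a => polyOp (-X 0) ![a]⟩
noncomputable instance : Zero (RamifiedWitt π B) := ⟨polyOp 0 ![]⟩
noncomputable instance : One (RamifiedWitt π B) := ⟨polyOp 1 ![]⟩

lemma op_add (f g : MvPolynomial ι O) (v : ι → RamifiedWitt π B) :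
    polyOp (f + g) v = polyOp f v + polyOp g v := by
  have h := op_op (X 0 + X 1) ![f, g] v
  rw [map_add, bind₁_X_right, bind₁_X_right] at h
  refine h.symm.trans (congrArg (polyOp (X 0 + X 1)) ?_)
  funext i; fin_cases i <;> rfl

lemma op_mul (f g : MvPolynomial ι O) (v : ι → RamifiedWitt π B) :
    polyOp (f * g) v = polyOp f v * polyOp g v := by
  have h := op_op (X 0 * X 1) ![f, g] v
  rw [map_mul, bind₁_X_right, bind₁_X_right] at h
  refine h.symm.trans (congrArg (polyOp (X 0 * X 1)) ?_)
  funext i; fin_cases i <;> rfl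

lemma op_neg (f : MvPolynomial ι O) (v : ι → RamifiedWitt π B) : polyOp (-f) v = -polyOp f v := by
  have h := op_op (-X 0) ![f] v
  rw [map_neg, bind₁_X_right] at h
  refine h.symm.trans (congrArg (polyOp (-X 0)) ?_)
  funext i; fin_cases i; rfl

lemma op_C (r : O) (v : ι → RamifiedWitt π B) : polyOp (C r) v = polyOp (C r) ![] := by
  have h := op_op (C r : MvPolynomial (Fin 0) O) ![] v
  rw [bind₁_C_right] at h
  exact h.symm.trans (congrArg _ (Subsingleton.elim _ _))

lemma op_zero (v : ι → RamifiedWitt π B) : polyOp 0 v = 0 := by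
  rw [← C_0, op_C, C_0]; rfl

lemma op_one (v : ι → RamifiedWitt π B) : polyOp 1 v = 1 := by
  rw [← C_1, op_C, C_1]; rfl

lemma exists_op (x y z : RamifiedWitt π B) : ∃ (v : Fin 3 → RamifiedWitt π B)
    (f g h : MvPolynomial (Fin 3) O), x = polyOp f v ∧ y = polyOp g v ∧ z = polyOp h v :=
  ⟨![x, y, z], X 0, X 1, X 2, (op_X 0 ![x, y, z]).symm, (op_X 1 ![x, y, z]).symm,
    (op_X 2 ![x, y, z]).symm⟩

noncomputable instance : CommRing (RamifiedWitt π B) where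
  add_assoc x y z := by
    obtain ⟨v, f, g, h, rfl, rfl, rfl⟩ := exists_op x y z
    simp only [← op_add, add_assoc]
  zero_add x := by
    obtain ⟨v, f, g, h, rfl, -, -⟩ := exists_op x x x
    rw [← op_zero v, ← op_add, zero_add]
  add_zero x := by
    obtain ⟨v, f, g, h, rfl, -, -⟩ := exists_op x x x
    rw [← op_zero v, ← op_add, add_zero]
  add_comm x y := by
    obtain ⟨v, f, g, h, rfl, rfl, -⟩ := exists_op x y y
    rw [← op_add, ← op_add, add_comm]
  nsmul := nsmulRec
  zsmul := zsmulRec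
  neg_add_cancel x := by
    obtain ⟨v, f, g, h, rfl, -, -⟩ := exists_op x x x
    rw [← op_neg, ← op_add, neg_add_cancel, op_zero]
  mul_assoc x y z := by
    obtain ⟨v, f, g, h, rfl, rfl, rfl⟩ := exists_op x y z
    simp only [← op_mul, mul_assoc]
  one_mul x := by
    obtain ⟨v, f, g, h, rfl, -, -⟩ := exists_op x x x
    rw [← op_one v, ← op_mul, one_mul]
  mul_one x := by
    obtain ⟨v, f, g, h, rfl, -, -⟩ := exists_op x x x
    rw [← op_one v, ← op_mul, mul_one]
  mul_comm x y := by
    obtain ⟨v, f, g, h, rfl, rfl, -⟩ := exists_op x y y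
    rw [← op_mul, ← op_mul, mul_comm]
  left_distrib x y z := by
    obtain ⟨v, f, g, h, rfl, rfl, rfl⟩ := exists_op x y z
    simp only [← op_mul, ← op_add, mul_add]
  right_distrib x y z := by
    obtain ⟨v, f, g, h, rfl, rfl, rfl⟩ := exists_op x y z
    simp only [← op_mul, ← op_add, add_mul]
  zero_mul x := by
    obtain ⟨v, f, g, h, rfl, -, -⟩ := exists_op x x x
    rw [← op_zero v, ← op_mul, zero_mul]
  mul_zero x := by
    obtain ⟨v, f, g, h, rfl, -, -⟩ := exists_op x x x
    rw [← op_zero v, ← op_mul, mul_zero]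

noncomputable instance : Algebra O (RamifiedWitt π B) :=
  RingHom.toAlgebra
    { toFun := fun r => polyOp (C r) ![]
      map_one' := by rw [C_1]; rfl
      map_mul' := fun r s => by rw [C_mul, op_mul]
      map_zero' := by rw [C_0]; rfl
      map_add' := fun r s => by rw [C_add, op_add] }

lemma algebraMap_eq_op (r : O) : algebraMap O (RamifiedWitt π B) r = polyOp (C r) ![] := rfl

/-- The ghost map `b ↦ (Φ_0(b), Φ_1(b), …)` is a homomorphism of `O`-algebras. -/
noncomputable def ghostHom : RamifiedWitt π B →ₐ[O] (ℕ → B) where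
  toFun b n := b.ghost n
  map_one' := by funext n; exact (ghost_op 1 ![] n).trans (by simp)
  map_mul' a b := by funext n; exact (ghost_op (X 0 * X 1) ![a, b] n).trans (by simp)
  map_zero' := by funext n; exact (ghost_op 0 ![] n).trans (by simp)
  map_add' a b := by funext n; exact (ghost_op (X 0 + X 1) ![a, b] n).trans (by simp)
  commutes' r := by funext n; exact (ghost_op (C r) ![] n).trans (by simp)

/-- Functoriality of the ramified Witt vectors. -/
noncomputable def map (φ : A →ₐ[O] B) : RamifiedWitt π A →ₐ[O] RamifiedWitt π B where
  toFun := mapFun φ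
  map_one' := (map_op φ 1 ![]).trans (congrArg _ (Subsingleton.elim _ _))
  map_mul' a b := (map_op φ (X 0 * X 1) ![a, b]).trans
    (congrArg (polyOp (X 0 * X 1)) (by funext i; fin_cases i <;> rfl))
  map_zero' := (map_op φ 0 ![]).trans (congrArg _ (Subsingleton.elim _ _))
  map_add' a b := (map_op φ (X 0 + X 1) ![a, b]).trans
    (congrArg (polyOp (X 0 + X 1)) (by funext i; fin_cases i <;> rfl))
  commutes' r := (map_op φ (C r) ![]).trans (congrArg _ (Subsingleton.elim _ _))

section Drinfeld

variable {O' : Type*} [CommRing O'] [IsDomain O'] [IsDiscreteValuationRing O']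
  [Algebra O O'] [IsLocalHom (algebraMap O O')] [Finite (ResidueField O')]

/-- The polynomials `u_n` over `O'` with `Φ'_n(u_0, u_1, …) = Φ_{r n}`, where `r` is the residue
degree of `O' / O` (see `aeval_drinfeldPoly`). -/
noncomputable def drinfeldPoly (π : Uniformizer O) (ϖ : Uniformizer O') : ℕ → MvPolynomial ℕ O' :=
  dworkSol (C ϖ.1) (residueCard O')
    fun n => MvPolynomial.map (algebraMap O O') (wittPhi π (residueDegree O O' * n))

lemma aeval_drinfeldPoly (π : Uniformizer O) (ϖ : Uniformizer O') (n : ℕ) :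
    aeval (drinfeldPoly π ϖ) (wittPhi ϖ n) =
      MvPolynomial.map (algebraMap O O') (wittPhi π (residueDegree O O' * n)) := by
  refine exists_ghost ϖ _ (fun n => ?_) n
  have hr : 0 < residueDegree O O' := by
    have : Module.Finite (ResidueField O) (ResidueField O') := Module.Finite.of_finite
    exact Module.finrank_pos
  have hq : residueCard O' = residueCard O ^ residueDegree O O' :=
    Module.natCard_eq_pow_finrank
  have hπ : ϖ.1 ∣ algebraMap O O' π.1 := by
    rw [ϖ.dvd_iff, ← ResidueField.algebraMap_residue, (π.dvd_iff π.1).1 dvd_rfl, map_zero]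
  have hn : n ≤ residueDegree O O' * n := Nat.le_mul_of_pos_left n hr
  rw [← map_expand, ← map_sub, hq]
  have hC : ∀ m, n + 1 ≤ m → C ϖ.1 ^ (n + 1) ∣
      (C (algebraMap O O' π.1) ^ m : MvPolynomial ℕ O') := fun m hm =>
    (pow_dvd_pow _ hm).trans (pow_dvd_pow_of_dvd (map_dvd C hπ) m)
  have key : ∀ s, C π.1 ^ (residueDegree O O' * n + 1) ∣
      expand (residueCard O ^ s) (wittPhi π (residueDegree O O' * n)) -
        wittPhi π (residueDegree O O' * n + s) := by
    intro s
    induction s with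
    | zero => simp
    | succ s ih =>
      have h1 := (pow_dvd_pow (C (σ := ℕ) π.1) (show residueDegree O O' * n + 1 ≤
        residueDegree O O' * n + s + 1 by omega)).trans
          (wittPhi_succ_dvd π (residueDegree O O' * n + s))
      have h2 := map_dvd (expand (residueCard O)) ih
      rw [map_pow, expand_C, map_sub, ← expand_mul, ← pow_succ'] at h2
      have := dvd_add h2 h1
      rwa [sub_add_sub_cancel] at this
  have h := map_dvd (MvPolynomial.map (σ := ℕ) (algebraMap O O')) (key (residueDegree O O'))
  rw [map_pow, map_C] at h
  rw [mul_add_one]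
  exact (hC _ (by omega)).trans h

variable {B : Type*} [CommRing B] [Algebra O B] [Algebra O' B] [IsScalarTower O O' B]
  {π : Uniformizer O} (ϖ : Uniformizer O')

/-- The map underlying Drinfeld's homomorphism; it satisfies `Φ'_n(u(b)) = Φ_{r n}(b)`, see
`ghost_drinfeldFun`. -/
noncomputable def drinfeldFun (b : RamifiedWitt π B) : RamifiedWitt ϖ B :=
  ⟨fun n => aeval b.coeff (drinfeldPoly π ϖ n)⟩

lemma ghost_drinfeldFun (b : RamifiedWitt π B) (n : ℕ) :
    (drinfeldFun ϖ b).ghost n = b.ghost (residueDegree O O' * n) := by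
  have h := congrArg (aeval b.coeff) (aeval_drinfeldPoly π ϖ n)
  rw [comp_aeval_apply, aeval_map_algebraMap] at h
  exact h

lemma drinfeldFun_map {A : Type*} [CommRing A] [Algebra O A] [Algebra O' A]
    (φ : A →ₐ[O'] B) (b : RamifiedWitt π A) :
    drinfeldFun ϖ (mapFun φ b) = mapFun φ (drinfeldFun ϖ b) := by
  ext n
  simp [drinfeldFun, mapFun, comp_aeval_apply]

lemma drinfeldFun_op (f : MvPolynomial ι O) (v : ι → RamifiedWitt π B) :
    drinfeldFun ϖ (polyOp f v) =
      polyOp (MvPolynomial.map (algebraMap O O') f) fun i => drinfeldFun ϖ (v i) := by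
  have h : drinfeldFun ϖ (polyOp f (univ π O' ι)) =
      polyOp (MvPolynomial.map (algebraMap O O') f) fun i => drinfeldFun ϖ (univ π O' ι i) :=
    ghost_ext isLeftRegular_algebraMap fun n => by
      simp only [ghost_drinfeldFun, ghost_op, aeval_map_algebraMap]
  have := congrArg (mapFun (aeval (R := O') fun p : ι × ℕ => (v p.1).coeff p.2)) h
  have h2 := map_op (AlgHom.restrictScalars O (aeval (R := O') fun p : ι × ℕ => (v p.1).coeff p.2))
    f (univ π O' ι)
  simp only [AlgHom.coe_restrictScalars'] at h2
  simpa only [map_op, mapFun_univ, ← drinfeldFun_map, h2] using this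

/-- Drinfeld's homomorphism `u : W_O(B) → W_{O'}(B)`, functorial in the `O'`-algebra `B`. -/
noncomputable def drinfeld : RamifiedWitt π B →+* RamifiedWitt ϖ B where
  toFun := drinfeldFun ϖ
  map_one' := (drinfeldFun_op ϖ 1 ![]).trans <| by rw [map_one]; exact op_one _
  map_mul' a b := (drinfeldFun_op ϖ (X 0 * X 1) ![a, b]).trans <| by
    rw [map_mul, op_mul, map_X, map_X, op_X, op_X]; rfl
  map_zero' := (drinfeldFun_op ϖ 0 ![]).trans <| by rw [map_zero]; exact op_zero _
  map_add' a b := (drinfeldFun_op ϖ (X 0 + X 1) ![a, b]).trans <| by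
    rw [map_add, op_add, map_X, map_X, op_X, op_X]; rfl

lemma drinfeld_algebraMap (r : O) :
    drinfeld ϖ (algebraMap O (RamifiedWitt π B) r) =
      algebraMap O' (RamifiedWitt ϖ B) (algebraMap O O' r) :=
  (drinfeldFun_op ϖ (C r) ![]).trans <| by rw [map_C, op_C]; rfl

lemma drinfeld_map {A : Type*} [CommRing A] [Algebra O A] [Algebra O' A] [IsScalarTower O O' A]
    (φ : A →ₐ[O'] B) (b : RamifiedWitt π A) :
    drinfeld ϖ (map (φ.restrictScalars O) b) = map φ (drinfeld ϖ b) :=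
  drinfeldFun_map ϖ φ b

open scoped TensorProduct

/-- The homomorphism `W_O(B) ⊗_O O' → W_{O'}(B)`, `b ⊗ x ↦ u(b) x`, extending Drinfeld's
homomorphism (see `drinfeldTensor_tmul`). -/
noncomputable def drinfeldTensor (π : Uniformizer O) (ϖ : Uniformizer O') (B : Type*) [CommRing B]
    [Algebra O B] [Algebra O' B] [IsScalarTower O O' B] :
    RamifiedWitt π B ⊗[O] O' →+* RamifiedWitt ϖ B :=
  letI : Algebra O (RamifiedWitt ϖ B) :=
    ((algebraMap O' (RamifiedWitt ϖ B)).comp (algebraMap O O')).toAlgebra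
  (Algebra.TensorProduct.lift (S := O)
    ({ drinfeld ϖ with commutes' := drinfeld_algebraMap ϖ } : RamifiedWitt π B →ₐ[O] RamifiedWitt ϖ B)
    ({ algebraMap O' (RamifiedWitt ϖ B) with commutes' := fun _ => rfl } :
      O' →ₐ[O] RamifiedWitt ϖ B) (fun _ _ => Commute.all _ _)).toRingHom

lemma drinfeldTensor_tmul (b : RamifiedWitt π B) (x : O') :
    drinfeldTensor π ϖ B (b ⊗ₜ x) = drinfeld ϖ b * algebraMap O' (RamifiedWitt ϖ B) x := by
  letI : Algebra O (RamifiedWitt ϖ B) :=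
    ((algebraMap O' (RamifiedWitt ϖ B)).comp (algebraMap O O')).toAlgebra
  exact Algebra.TensorProduct.lift_tmul _ _ _ _ _

lemma drinfeldTensor_map {A : Type*} [CommRing A] [Algebra O A] [Algebra O' A] [IsScalarTower O O' A]
    (φ : A →ₐ[O'] B) (x : RamifiedWitt π A ⊗[O] O') :
    drinfeldTensor π ϖ B (Algebra.TensorProduct.map (map (φ.restrictScalars O)) (AlgHom.id O O') x) =
      map φ (drinfeldTensor π ϖ A x) := by
  induction x with
  | zero => simp
  | add x y hx hy => simp only [map_add, hx, hy]
  | tmul b x => simp only [Algebra.TensorProduct.map_tmul, drinfeldTensor_tmul, drinfeld_map, map_mul,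
      AlgHom.commutes, AlgHom.id_apply]

end Drinfeld

end RamifiedWitt

namespace RamWitt

section Schemes

open MvPolynomial IsLocalRing CategoryTheory Opposite
open scoped TensorProduct

universe w v u

/-- Restriction of scalars for commutative algebras. -/
noncomputable def restrictAlg (R : Type u) (S : Type v) [CommRing R] [CommRing S] [Algebra R S] :
    CommAlgCat.{w} S ⥤ CommAlgCat.{w} R where
  obj B := letI := Algebra.compHom B (algebraMap R S); CommAlgCat.of R B
  map {A B} φ :=
    letI := Algebra.compHom A (algebraMap R S)
    letI := Algebra.compHom B (algebraMap R S)
    CommAlgCat.ofHom { φ.hom with commutes' := fun r => φ.hom.commutes (algebraMap R S r) }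

/-- The underlying additive group of a commutative ring, written multiplicatively. -/
def addGroupFunctor : CommRingCat.{v} ⥤ GrpCat.{v} where
  obj R := GrpCat.of (Multiplicative R)
  map φ := GrpCat.ofHom (AddMonoidHom.toMultiplicative φ.hom.toAddMonoidHom)

section Representable

variable {R : Type v} [CommRing R]

/-- Coordinates, indexed by `σ`, on a ring valued functor on `R`-algebras: a natural bijection of
`F(B)` with `B ^ σ`. -/
structure Coordinates (F : CommAlgCat.{v} R ⥤ CommRingCat.{v}) (σ : Type) where
  /-- The coordinates of an element of `F(B)`. -/
  equiv (B : CommAlgCat.{v} R) : F.obj B ≃ (σ → B)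
  naturality {B C : CommAlgCat.{v} R} (φ : B ⟶ C) (x : F.obj B) (i : σ) :
    equiv C (F.map φ x) i = φ.hom (equiv B x i)

namespace Coordinates

variable {F G : CommAlgCat.{v} R ⥤ CommRingCat.{v}} {σ τ : Type}

/-- The additive group of `F` as a presheaf on affine `R`-schemes. -/
def presheaf (F : CommAlgCat.{v} R ⥤ CommRingCat.{v}) : (CommAlgCat.{v} R)ᵒᵖᵒᵖ ⥤ GrpCat.{v} :=
  unopUnop _ ⋙ F ⋙ addGroupFunctor

/-- A ring valued functor with coordinates indexed by `σ` is represented by the polynomial ring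
`R[X_s; s ∈ σ]`. -/
noncomputable def representableBy (c : Coordinates F σ) :
    (presheaf F ⋙ forget _).RepresentableBy (op (CommAlgCat.of R (MvPolynomial σ R))) where
  homEquiv {X} :=
    { toFun := fun f => Multiplicative.ofAdd ((c.equiv X.unop).symm fun i => f.unop.hom (MvPolynomial.X i))
      invFun := fun x => (CommAlgCat.ofHom (aeval (c.equiv X.unop (Multiplicative.toAdd x)))).op
      left_inv := fun f => by
        apply Quiver.Hom.unop_inj
        ext i
        change aeval (c.equiv X.unop ((c.equiv X.unop).symm _)) (MvPolynomial.X i) = _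
        rw [Equiv.apply_symm_apply, aeval_X]
      right_inv := fun x => by
        change (c.equiv X.unop).symm (fun i => aeval _ (MvPolynomial.X i)) = Multiplicative.toAdd x
        simp only [aeval_X]
        exact (c.equiv X.unop).symm_apply_apply _ }
  homEquiv_comp {X Y} f g := by
    apply (c.equiv X.unop).injective
    funext i
    change c.equiv X.unop ((c.equiv X.unop).symm _) i =
      c.equiv X.unop (F.map f.unop ((c.equiv Y.unop).symm _)) i
    rw [c.naturality, Equiv.apply_symm_apply, Equiv.apply_symm_apply]
    rfl

/-- The spectrum of `R[X_s; s ∈ σ]`, with the additive group structure of the functor `F` which it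
represents. -/
noncomputable def groupObj (c : Coordinates F σ) : Grp (CommAlgCat.{v} R)ᵒᵖ :=
  letI := GrpObj.ofRepresentableBy _ (presheaf F) c.representableBy
  ⟨op (CommAlgCat.of R (MvPolynomial σ R))⟩

/-- The homomorphism of affine group schemes that induces a given natural transformation of ring
valued functors. -/
noncomputable def groupHom (c : Coordinates F σ) (d : Coordinates G τ) (α : F ⟶ G) :
    c.groupObj ⟶ d.groupObj :=
  yonedaGrpFullyFaithful.preimage
    ((yonedaGrpObjIsoOfRepresentableBy _ (presheaf F) c.representableBy).hom ≫
      (Functor.whiskerLeft (unopUnop _) (Functor.whiskerRight α addGroupFunctor)) ≫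
      (yonedaGrpObjIsoOfRepresentableBy _ (presheaf G) d.representableBy).inv)

end Coordinates

end Representable

section Functors

variable {O : Type u} [CommRing O] [IsDomain O] [IsDiscreteValuationRing O]
  [Finite (ResidueField O)]

/-- The functor `B ↦ W_O(B)` on `O`-algebras. -/
noncomputable def wittFunctor (π : Uniformizer O) : CommAlgCat.{w} O ⥤ CommRingCat.{w} where
  obj B := CommRingCat.of (RamifiedWitt π B)
  map φ := CommRingCat.ofHom (RamifiedWitt.map φ.hom).toRingHom

/-- The coordinates of the Witt vector functor are the Witt components. -/
def wittCoordinates (π : Uniformizer O) (R : Type v) [CommRing R] [Algebra O R] :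
    Coordinates (restrictAlg O R ⋙ wittFunctor π) ℕ where
  equiv _ := ⟨RamifiedWitt.coeff, RamifiedWitt.mk, fun _ => rfl, fun _ => rfl⟩
  naturality _ _ _ := rfl

variable {O' : Type v} [CommRing O'] [IsDomain O'] [IsDiscreteValuationRing O']
  [Finite (ResidueField O')] [Algebra O O']

variable (O') in
/-- The functor `B ↦ W_O(B) ⊗_O O'` on `O'`-algebras. -/
noncomputable def wittTensorFunctor (π : Uniformizer O) : CommAlgCat.{v} O' ⥤ CommRingCat.{v} where
  obj B := CommRingCat.of (RamifiedWitt π ((restrictAlg O O').obj B) ⊗[O] O')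
  map φ := CommRingCat.ofHom (Algebra.TensorProduct.map
    (RamifiedWitt.map ((restrictAlg O O').map φ).hom) (AlgHom.id O O')).toRingHom
  map_id B := CommRingCat.hom_ext <| RingHom.ext fun x => by
    exact DFunLike.congr_fun (Algebra.TensorProduct.map_id (R := O) (S := O)
      (A := RamifiedWitt π ((restrictAlg O O').obj B)) (B := O')) x
  map_comp φ ψ := CommRingCat.hom_ext <| RingHom.ext fun x => by
    exact DFunLike.congr_fun (Algebra.TensorProduct.map_comp (R := O) (S := O)
      (RamifiedWitt.map (π := π) ((restrictAlg O O').map ψ).hom)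
      (RamifiedWitt.map (π := π) ((restrictAlg O O').map φ).hom)
      (AlgHom.id O O') (AlgHom.id O O')) x

variable [IsLocalHom (algebraMap O O')]

/-- The morphism `u ⊗ id : W_O(B) ⊗_O O' → W_{O'}(B)`, natural in the `O'`-algebra `B`. -/
noncomputable def uRa (π : Uniformizer O) (ϖ : Uniformizer O') :
    wittTensorFunctor O' π ⟶ wittFunctor ϖ where
  app B :=
    letI := Algebra.compHom B (algebraMap O O')
    haveI : IsScalarTower O O' B := .of_algebraMap_eq fun _ => rfl
    CommRingCat.ofHom (RamifiedWitt.drinfeldTensor π ϖ B)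
  naturality {A B} φ := by
    let _ := Algebra.compHom A (algebraMap O O')
    let _ := Algebra.compHom B (algebraMap O O')
    have : IsScalarTower O O' A := .of_algebraMap_eq fun _ => rfl
    have : IsScalarTower O O' B := .of_algebraMap_eq fun _ => rfl
    have h := fun x => RamifiedWitt.drinfeldTensor_map (π := π) (A := A) (B := B) ϖ φ.hom x
    exact CommRingCat.hom_ext <| RingHom.ext fun x => h x

variable [Module.Finite O O'] [FaithfulSMul O O']

/-- The bijection `W_O(B) ^ e → W_O(B) ⊗_O O'`, `(b_i)_i ↦ ∑ b_i ⊗ ϖ ^ i`, for `O' / O` totally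
ramified of degree `e`. -/
noncomputable def tensorEquiv (h : IsTotallyRamified O O') (π : Uniformizer O)
    (ϖ : Uniformizer O') {e : ℕ} (he : Module.finrank O O' = e) (B : Type w) [CommRing B]
    [Algebra O B] : (Fin e → RamifiedWitt π B) ≃ RamifiedWitt π B ⊗[O] O' :=
  Equiv.ofBijective (fun b => ∑ i, b i ⊗ₜ[O] (ϖ.1 ^ (i : ℕ)))
    (h.sum_tmul_bijective ϖ.2 he (RamifiedWitt π B))

lemma tensorEquiv_map (h : IsTotallyRamified O O') (π : Uniformizer O)
    (ϖ : Uniformizer O') {e : ℕ} (he : Module.finrank O O' = e) {B C : Type w} [CommRing B]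
    [Algebra O B] [CommRing C] [Algebra O C] (φ : B →ₐ[O] C) (b : Fin e → RamifiedWitt π B) :
    tensorEquiv h π ϖ he C (fun i => RamifiedWitt.map φ (b i)) =
      Algebra.TensorProduct.map (RamifiedWitt.map φ) (AlgHom.id O O')
        (tensorEquiv h π ϖ he B b) := by
  simp only [tensorEquiv, Equiv.ofBijective_apply, map_sum, Algebra.TensorProduct.map_tmul, map_pow,
    AlgHom.id_apply]

lemma tensorEquiv_symm_map (h : IsTotallyRamified O O') (π : Uniformizer O)
    (ϖ : Uniformizer O') {e : ℕ} (he : Module.finrank O O' = e) {B C : Type w} [CommRing B]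
    [Algebra O B] [CommRing C] [Algebra O C] (φ : B →ₐ[O] C) (x : RamifiedWitt π B ⊗[O] O') :
    (tensorEquiv h π ϖ he C).symm
      (Algebra.TensorProduct.map (RamifiedWitt.map φ) (AlgHom.id O O') x) =
      fun i => RamifiedWitt.map φ ((tensorEquiv h π ϖ he B).symm x i) := by
  rw [Equiv.symm_apply_eq, tensorEquiv_map, Equiv.apply_symm_apply]

/-- The coordinates of `∑ b_i ⊗ ϖ ^ i` in `W_O(B) ⊗_O O'` are the Witt components of
`b_0, …, b_{e - 1}`; the coordinate with index `(n, i)` is the `n`-th component of `b_i`. -/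
noncomputable def wittTensorCoordinates (h : IsTotallyRamified O O') (π : Uniformizer O)
    (ϖ : Uniformizer O') {e : ℕ} (he : Module.finrank O O' = e)
    (R : Type v) [CommRing R] [Algebra O' R] :
    Coordinates (restrictAlg O' R ⋙ wittTensorFunctor O' π) (ℕ × Fin e) where
  equiv B := (tensorEquiv h π ϖ he ((restrictAlg O O').obj ((restrictAlg O' R).obj B))).symm.trans
      ⟨fun b p => (b p.2).coeff p.1, fun f i => ⟨fun n => f (n, i)⟩, fun _ => rfl, fun _ => rfl⟩
  naturality {B C} φ x i := by
    exact congrArg (fun b => (b i.2).coeff i.1) (tensorEquiv_symm_map h π ϖ he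
      ((restrictAlg O O').map ((restrictAlg O' R).map φ)).hom x)


open AlgebraicGeometry Limits

/-- A universal homeomorphism: every base change is a homeomorphism. -/
def IsUniversalHomeomorphism {X Y : Scheme.{v}} (f : X ⟶ Y) : Prop :=
  (topologically @IsHomeomorph).universally f

/-- A finite group scheme over `S` with exactly one point (the unit section provides it). -/
structure IsInfinitesimal {S : Scheme.{v}} (G : Grp (Over S)) : Prop where
  isFinite : IsFinite G.X.hom
  subsingleton : Subsingleton G.X.left

/-- A limit, in the category of group schemes, of a cofiltered system of infinitesimal group
schemes. -/
def IsProInfinitesimal {S : Scheme.{v}} (G : Grp (Over S)) : Prop :=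
  ∃ (J : Type v) (_ : SmallCategory J) (_ : IsCofiltered J) (F : J ⥤ Grp (Over S))
    (p : (Functor.const J).obj G ⟶ F),
    (∀ j, IsInfinitesimal (F.obj j)) ∧ Nonempty (IsLimit (Cone.mk G p))

/-- The functor from affine group schemes, given as group objects in the opposite category of
`R`-algebras, to group schemes over `Spec R`. -/
noncomputable def groupSchemeFunctor (R : CommRingCat.{v}) :
    Grp (CommAlgCat.{v} R)ᵒᵖ ⥤ Grp (Over (Spec R)) :=
  (algSpec R).mapGrp

variable (O') in
/-- The residue field of `O'` as an object of the category of commutative rings. -/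
abbrev residueRing := CommRingCat.of (ResidueField O')

/-- The special fibre of the scheme of ramified Witt vectors over `O'`, as an additive group
scheme over the residue field `k` of `O'`. -/
noncomputable def wittSpecial (ϖ : Uniformizer O') : Grp (Over (Spec (residueRing O'))) :=
  (groupSchemeFunctor (residueRing O')).obj (wittCoordinates ϖ (ResidueField O')).groupObj

/-- The scheme `Spec k[X_{n,i}; n ∈ ℕ, 0 ≤ i < e]` over the residue field `k` of `O'`, product of
`e` copies of the special fibre of the scheme of ramified Witt vectors over `O`, with the additive
group structure of `B ↦ W_O(B) ⊗_O O'`. -/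
noncomputable def wittTensorSpecial (h : IsTotallyRamified O O') (π : Uniformizer O)
    (ϖ : Uniformizer O') {e : ℕ} (he : Module.finrank O O' = e) : Grp (Over (Spec (residueRing O'))) :=
  (groupSchemeFunctor (residueRing O')).obj (wittTensorCoordinates h π ϖ he (ResidueField O')).groupObj

/-- The homomorphism of group schemes induced by `u ⊗ id` on the special fibres. -/
noncomputable def uRaSpecial (h : IsTotallyRamified O O') (π : Uniformizer O)
    (ϖ : Uniformizer O') {e : ℕ} (he : Module.finrank O O' = e) :
    wittTensorSpecial h π ϖ he ⟶ wittSpecial ϖ :=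
  (groupSchemeFunctor (residueRing O')).map (Coordinates.groupHom _ _
    (Functor.whiskerLeft (restrictAlg O' (ResidueField O')) (uRa π ϖ)))

end Functors

end Schemes

end RamWitt

/-! Write `π = η ϖ ^ e` with `η` a unit of `O'`, and let `V` be the shift of Witt vectors and `[b]`
the Teichmüller representative. Comparing ghost components gives `u [b] = [b]` and `u (V b) = (π /
ϖ) V (u b) = η ϖ ^ (e - 1) V (u b)` (`drinfeld_teichmuller`, `drinfeld_shift`). On algebras over the
residue field, multiplication by `ϖ` is the shift of the componentwise `q`-th power
(`uniformizer_smul`), so `ϖ ^ r V ^ n [b] = V ^ (n + r) [b ^ q ^ r]`. Hence `ϖ ^ i u (V ^ n [b]) = η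
^ n V ^ (n e + i) [b ^ q ^ (n (e - 1) + i)]`.

Every `j` is uniquely `n e + i` with `i < e`. Summing over the expansions `b_i = ∑ V ^ n [X_{n,i}]`
therefore gives `u^ra (∑ b_i ⊗ ϖ ^ i) = ∑_j η ^ ⌊j / e⌋ V ^ j [c_j]` with `c_{n e + i} = X_{n,i} ^ q
^ (n (e - 1) + i)` (`coeff_sum_drinfeld_mul`). The `m`-th Witt component of this sum is a unit times
`c_m` plus a polynomial in the earlier `c_j`. So `c` and the Witt components determine each other by
a triangular change of coordinates, an automorphism of the infinite affine space that fixes `0`.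

Up to this automorphism of the target, `u^ra` is thus the map which raises each coordinate to a
power of `q`. On rings it is injective, integral and purely inseparable, so it is a universal
homeomorphism. Its kernel is cut out by the vanishing of these powers. Truncation to the first `N`
Witt components exhibits the kernel as a sequential limit of group schemes whose rings are generated
by finitely many nilpotent variables, hence are finite with one point.

The group structures live on functors of points: kernels and limits are computed on points by the
Yoneda lemma and then carried to schemes by `algSpec`. -/

namespace RamifiedWitt

open RamWitt MvPolynomial IsLocalRing

/-! ### Verschiebung, Teichmüller expansions, and multiplication by the uniformizer. -/

section Verschiebung

variable {O : Type*} [CommRing O] [IsDomain O] [IsDiscreteValuationRing O]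
  {π : Uniformizer O} {A B : Type*} [CommRing A] [CommRing B] [Algebra O A] [Algebra O B]

/-- The shift `(b_0, b_1, …) ↦ (0, b_0, b_1, …)`. -/
def shift (b : RamifiedWitt π B) : RamifiedWitt π B :=
  ⟨fun n => n.casesOn 0 b.coeff⟩

/-- The inverse shift `(b_0, b_1, …) ↦ (b_1, b_2, …)`. -/
def tail (b : RamifiedWitt π B) : RamifiedWitt π B := ⟨fun n => b.coeff (n + 1)⟩

/-- The Teichmüller representative `(b, 0, 0, …)`. -/
def teichmuller (π : Uniformizer O) (b : B) : RamifiedWitt π B := ⟨fun n => n.casesOn b fun _ => 0⟩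

/-- Raising all components to the power `q`. -/
noncomputable def frobeniusFun (b : RamifiedWitt π B) : RamifiedWitt π B :=
  ⟨fun n => b.coeff n ^ residueCard O⟩

lemma ghost_eq_sum (b : RamifiedWitt π B) (n : ℕ) :
    b.ghost n = ∑ i ∈ Finset.range (n + 1),
      algebraMap O B π.1 ^ i * b.coeff i ^ residueCard O ^ (n - i) :=
  aeval_wittPhi π b.coeff n

lemma ghost_zero (b : RamifiedWitt π B) : b.ghost 0 = b.coeff 0 := by
  simp [ghost_eq_sum]

variable [Finite (ResidueField O)]

lemma residueCard_pos : 0 < residueCard O := Nat.card_pos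

lemma residueCard_pow_ne_zero (n : ℕ) : residueCard O ^ n ≠ 0 := pow_ne_zero _ residueCard_pos.ne'

lemma ghost_shift_zero (b : RamifiedWitt π B) : b.shift.ghost 0 = 0 := by
  simp [ghost_eq_sum, shift]

lemma ghost_shift_succ (b : RamifiedWitt π B) (n : ℕ) :
    b.shift.ghost (n + 1) = algebraMap O B π.1 * b.ghost n := by
  rw [ghost_eq_sum, ghost_eq_sum, Finset.sum_range_succ', Finset.mul_sum]
  rw [show b.shift.coeff 0 = 0 from rfl, zero_pow (residueCard_pow_ne_zero _), mul_zero, add_zero]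
  simp only [shift, pow_succ', mul_assoc, Nat.add_sub_add_right]

lemma ghost_teichmuller (b : B) (n : ℕ) :
    (teichmuller π b).ghost n = b ^ residueCard O ^ n := by
  rw [ghost_eq_sum, Finset.sum_range_succ']
  simp [teichmuller, zero_pow (residueCard_pow_ne_zero _)]

lemma ghost_tail (b : RamifiedWitt π B) (n : ℕ) :
    b.ghost (n + 1) = b.coeff 0 ^ residueCard O ^ (n + 1) + algebraMap O B π.1 * b.tail.ghost n := by
  rw [ghost_eq_sum, ghost_eq_sum, Finset.sum_range_succ', Finset.mul_sum]
  simp only [tail, pow_succ' (algebraMap O B π.1), mul_assoc, Nat.add_sub_add_right]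
  rw [add_comm]
  simp

lemma ghost_add (b c : RamifiedWitt π B) (n : ℕ) : (b + c).ghost n = b.ghost n + c.ghost n :=
  congrFun (map_add ghostHom b c) n

lemma ghost_smul (r : O) (b : RamifiedWitt π B) (n : ℕ) :
    (r • b).ghost n = algebraMap O B r * b.ghost n :=
  (congrFun (map_smul ghostHom r b) n).trans (Algebra.smul_def _ _)

lemma coeff_zero_add (b c : RamifiedWitt π B) : (b + c).coeff 0 = b.coeff 0 + c.coeff 0 := by
  simpa only [ghost_zero] using ghost_add b c 0

lemma coeff_zero_smul (r : O) (b : RamifiedWitt π B) :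
    (r • b).coeff 0 = algebraMap O B r * b.coeff 0 := by
  simpa only [ghost_zero] using ghost_smul r b 0

lemma coeff_map (φ : A →ₐ[O] B) (b : RamifiedWitt π A) (n : ℕ) :
    (map φ b).coeff n = φ (b.coeff n) := rfl

lemma map_shift (φ : A →ₐ[O] B) (b : RamifiedWitt π A) : map φ b.shift = (map φ b).shift := by
  ext n
  cases n
  · exact map_zero φ
  · rfl

lemma map_tail (φ : A →ₐ[O] B) (b : RamifiedWitt π A) : map φ b.tail = (map φ b).tail := rfl

lemma map_teichmuller (φ : A →ₐ[O] B) (b : A) :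
    map φ (teichmuller π b) = teichmuller π (φ b) := by
  ext n
  cases n
  · rfl
  · exact map_zero φ

lemma map_univ {R ι : Type*} [CommRing R] [Algebra O R] [Algebra R B] [IsScalarTower O R B]
    (v : ι → RamifiedWitt π B) (i : ι) :
    map ((aeval (R := R) fun p : ι × ℕ => (v p.1).coeff p.2).restrictScalars O) (univ π R ι i) =
      v i :=
  mapFun_univ v i

/-- Reduction to the universal case: over a polynomial ring over `O` the uniformizer is regular, so
an identity natural in the vectors can be checked there on ghost components and then specialised. -/
lemma exists_map_univ {ι : Type*} (v : ι → RamifiedWitt π B) :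
    ∃ φ : MvPolynomial (ι × ℕ) O →ₐ[O] B, ∀ i, map φ (univ π O ι i) = v i :=
  ⟨_, map_univ v⟩

lemma shift_add (b c : RamifiedWitt π B) : (b + c).shift = b.shift + c.shift := by
  obtain ⟨φ, h⟩ := exists_map_univ ![b, c]
  rw [← show _ = b from h 0, ← show _ = c from h 1, ← map_add, ← map_shift, ← map_shift,
    ← map_shift, ← map_add]
  congr 1
  refine ghost_ext isLeftRegular_algebraMap fun n => ?_
  cases n <;> simp only [ghost_add, ghost_shift_zero, ghost_shift_succ, mul_add, add_zero]

lemma shift_smul (r : O) (b : RamifiedWitt π B) : (r • b).shift = r • b.shift := by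
  obtain ⟨φ, h⟩ := exists_map_univ ![b]
  rw [← show _ = b from h 0, ← map_smul, ← map_shift, ← map_shift, ← map_smul]
  congr 1
  refine ghost_ext isLeftRegular_algebraMap fun n => ?_
  cases n <;> simp only [ghost_smul, ghost_shift_zero, ghost_shift_succ, mul_zero, mul_left_comm]

/-- The Verschiebung as a linear map. -/
@[simps]
def verschiebung : RamifiedWitt π B →ₗ[O] RamifiedWitt π B where
  toFun := shift
  map_add' := shift_add
  map_smul' := shift_smul

lemma teichmuller_add_shift_tail (b : RamifiedWitt π B) :
    teichmuller π (b.coeff 0) + b.tail.shift = b := by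
  obtain ⟨φ, h⟩ := exists_map_univ ![b]
  rw [← show _ = b from h 0, coeff_map, ← map_teichmuller, ← map_tail, ← map_shift, ← map_add]
  congr 1
  refine ghost_ext isLeftRegular_algebraMap fun n => ?_
  cases n with
  | zero => rw [ghost_add, ghost_shift_zero, ghost_teichmuller, ghost_zero]; simp
  | succ n => rw [ghost_add, ghost_shift_succ, ghost_teichmuller, ghost_tail]

lemma coeff_teichmuller_add_shift_zero (a : B) (b : RamifiedWitt π B) :
    (teichmuller π a + b.shift).coeff 0 = a := by
  rw [coeff_zero_add]
  exact add_zero a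

/-- There is no carry because the supports are disjoint: `teichmuller_add_shift_tail`, for the
vector `(a, b_0, b_1, …)`, says that this vector is the sum. -/
lemma coeff_teichmuller_add_shift_succ (a : B) (b : RamifiedWitt π B) (n : ℕ) :
    (teichmuller π a + b.shift).coeff (n + 1) = b.coeff n := by
  have h := teichmuller_add_shift_tail (π := π) ⟨fun n => n.casesOn (motive := fun _ => B) a b.coeff⟩
  exact congrArg (fun x => x.coeff (n + 1)) h

lemma coeff_verschiebung_pow (b : RamifiedWitt π B) (m n : ℕ) :
    ((verschiebung ^ m) b).coeff n = if n < m then 0 else b.coeff (n - m) := by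
  induction m generalizing n with
  | zero => simp
  | succ m ih =>
    rw [pow_succ', Module.End.mul_apply]
    cases n with
    | zero => simp [shift]
    | succ n => simpa [shift] using ih n

/-- Peeling off `[x_0]` turns `x + V ^ (m + 1) y` into `[x_0] + V (tail x + V ^ m y)`, which allows
induction. This is the source of all triangularity below: a term in the image of `V ^ m` first acts
in component `m`, and there additively. -/
lemma coeff_add_verschiebung_pow (x y : RamifiedWitt π B) (m : ℕ) :
    (∀ j < m, (x + (verschiebung ^ m) y).coeff j = x.coeff j) ∧
      (x + (verschiebung ^ m) y).coeff m = x.coeff m + y.coeff 0 := by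
  induction m generalizing x with
  | zero => simp [coeff_zero_add]
  | succ m ih =>
    have h : x + (verschiebung ^ (m + 1)) y = teichmuller π (x.coeff 0) +
        (x.tail + (verschiebung ^ m) y).shift := by
      rw [shift_add, ← add_assoc, teichmuller_add_shift_tail, pow_succ', Module.End.mul_apply,
        verschiebung_apply]
    rw [h]
    refine ⟨fun j hj => ?_, ?_⟩
    · cases j with
      | zero => rw [coeff_teichmuller_add_shift_zero]
      | succ j =>
        rw [coeff_teichmuller_add_shift_succ, (ih x.tail).1 j (by omega)]
        rfl
    · rw [coeff_teichmuller_add_shift_succ, (ih x.tail).2]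
      rfl

/-- The expansion `b = ∑_{n < N} V ^ n [b_n] + V ^ N (b_N, b_{N + 1}, …)`. -/
lemma eq_sum_add_verschiebung_pow (b : RamifiedWitt π B) (N : ℕ) :
    b = ∑ n ∈ Finset.range N, (verschiebung ^ n) (teichmuller π (b.coeff n)) +
      (verschiebung ^ N) ⟨fun n => b.coeff (N + n)⟩ := by
  induction N with
  | zero => simp
  | succ N ih =>
    conv_lhs => rw [ih, ← teichmuller_add_shift_tail ⟨fun n => b.coeff (N + n)⟩]
    rw [Finset.sum_range_succ, add_assoc, map_add, pow_succ, Module.End.mul_apply,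
      verschiebung_apply]
    simp only [tail, add_assoc, add_comm, add_left_comm, add_zero]

lemma exists_verschiebung_pow_eq {b : RamifiedWitt π B} {N : ℕ} (h : ∀ n < N, b.coeff n = 0) :
    ∃ c, (verschiebung ^ N) c = b := by
  refine ⟨⟨fun n => b.coeff (N + n)⟩, ?_⟩
  ext n
  rw [coeff_verschiebung_pow]
  split_ifs with hn
  · exact (h n hn).symm
  · exact congrArg b.coeff (by omega)

/-- The image of `V ^ N` is a subgroup whose cosets are the fibres of the first `N` components. This
is what makes truncated kernels into groups. -/
lemma coeff_sub_eq_zero_iff (x y : RamifiedWitt π B) (N : ℕ) :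
    (∀ n < N, (x - y).coeff n = 0) ↔ ∀ n < N, x.coeff n = y.coeff n := by
  constructor
  · intro h n hn
    obtain ⟨c, hc⟩ := exists_verschiebung_pow_eq h
    rw [← sub_add_cancel x y, ← hc, add_comm, (coeff_add_verschiebung_pow y c N).1 n hn]
  · intro h n hn
    rw [x.eq_sum_add_verschiebung_pow N, y.eq_sum_add_verschiebung_pow N,
      Finset.sum_congr rfl fun n hn => by rw [h n (Finset.mem_range.1 hn)],
      add_sub_add_left_eq_sub, ← map_sub, coeff_verschiebung_pow, if_pos hn]

lemma coeff_zero_eq (n : ℕ) : (0 : RamifiedWitt π B).coeff n = 0 := by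
  -- The zero of the ring is defined through ghost polynomials, so its components are not `0` by
  -- definition; but by linearity it lies in the image of every power of `V`.
  have h := coeff_verschiebung_pow (0 : RamifiedWitt π B) (n + 1) n
  rwa [map_zero, if_pos n.lt_succ_self] at h

/-- If `π` divides `b_i` for `i < n`, then `π ^ (n + 1)` divides the terms `π ^ i b_i ^ q ^ (n - i)`
of `Φ_n`, which leaves `π ^ (n + 1) ∣ π ^ n b_n`. It turns congruences of ghost components into
congruences of Witt components modulo `π`. -/
lemma dvd_coeff_of_ghost {b : RamifiedWitt π A} (hπ : IsLeftRegular (algebraMap O A π.1))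
    (h : ∀ n, algebraMap O A π.1 ^ (n + 1) ∣ b.ghost n) (n : ℕ) :
    algebraMap O A π.1 ∣ b.coeff n := by
  induction n using Nat.strong_induction_on with
  | _ n ih =>
    have hn := h n
    rw [ghost_eq_sum, Finset.sum_range_succ, Nat.sub_self, pow_zero, pow_one] at hn
    have hs : algebraMap O A π.1 ^ (n + 1) ∣ ∑ i ∈ Finset.range n,
        algebraMap O A π.1 ^ i * b.coeff i ^ residueCard O ^ (n - i) := by
      refine Finset.dvd_sum fun i hi => ?_
      have hi := Finset.mem_range.1 hi
      -- As `q ≥ 2`, the exponent `i + q ^ (n - i)` is at least `n + 1`.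
      have hq : n - i < residueCard O ^ (n - i) := Nat.lt_pow_self Finite.one_lt_card
      refine (pow_dvd_pow _ (show n + 1 ≤ i + residueCard O ^ (n - i) by omega)).trans ?_
      rw [pow_add]
      exact mul_dvd_mul_left _ (pow_dvd_pow_of_dvd (ih i hi) _)
    obtain ⟨c, hc⟩ := (dvd_add_right hs).1 hn
    refine ⟨c, (hπ.pow n) ?_⟩
    simp only
    rw [hc]
    ring

/-- On algebras over the residue field, multiplication by the uniformizer shifts the components
and raises them to the power `q`. -/
lemma uniformizer_smul (hπ : algebraMap O B π.1 = 0) (b : RamifiedWitt π B) :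
    π.1 • b = b.frobeniusFun.shift := by
  obtain ⟨φ, h⟩ := exists_map_univ ![b]
  -- For the universal vector the two sides differ in ghost component `n + 1` only by `π` times the
  -- last term `π ^ (n + 1) b_{n + 1}` of `Φ_{n + 1}`. So all components of the difference are
  -- divisible by `π`, and they vanish after specialisation.
  have hd : ∀ n, algebraMap O (MvPolynomial (Fin 1 × ℕ) O) π.1 ∣
      (π.1 • univ π O (Fin 1) 0 - (univ π O (Fin 1) 0).frobeniusFun.shift).coeff n := by
    refine dvd_coeff_of_ghost isLeftRegular_algebraMap fun n => ?_
    have hs : ∀ x y : RamifiedWitt π (MvPolynomial (Fin 1 × ℕ) O), (x - y).ghost n =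
        x.ghost n - y.ghost n := fun x y => congrFun (map_sub ghostHom x y) n
    rw [hs, ghost_smul]
    cases n with
    | zero => rw [ghost_shift_zero, sub_zero, zero_add, pow_one]; exact dvd_mul_right _ _
    | succ n =>
      rw [ghost_shift_succ, ← mul_sub, pow_succ']
      refine mul_dvd_mul_left _ ?_
      rw [ghost_eq_sum, ghost_eq_sum, Finset.sum_range_succ, add_sub_right_comm,
        ← Finset.sum_sub_distrib, Finset.sum_eq_zero, zero_add]
      · exact dvd_mul_right _ _
      intro i hi
      have hi := Nat.lt_succ_iff.1 (Finset.mem_range.1 hi)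
      simp only [frobeniusFun]
      rw [← pow_mul, ← pow_succ', Nat.succ_sub hi, sub_self]
  have h0 : map φ (π.1 • univ π O (Fin 1) 0 - (univ π O (Fin 1) 0).frobeniusFun.shift) = 0 := by
    ext n
    obtain ⟨c, hc⟩ := hd n
    rw [coeff_map, hc, map_mul, AlgHom.commutes, hπ, zero_mul, coeff_zero_eq]
  rw [map_sub, map_smul, map_shift, sub_eq_zero] at h0
  rw [← show _ = b from h 0, h0]
  congr 1
  ext n
  simp only [frobeniusFun, coeff_map, map_pow]

lemma uniformizer_pow_smul_teichmuller (hπ : algebraMap O B π.1 = 0) (b : B) (m j : ℕ) :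
    π.1 ^ j • (verschiebung ^ m) (teichmuller π b) =
      (verschiebung ^ (m + j)) (teichmuller π (b ^ residueCard O ^ j)) := by
  induction j with
  | zero => simp
  | succ j ih =>
    rw [pow_succ', mul_smul, ih, uniformizer_smul hπ, ← add_assoc, pow_succ' verschiebung,
      Module.End.mul_apply, verschiebung_apply]
    congr 1
    ext n
    simp only [frobeniusFun, coeff_verschiebung_pow]
    split_ifs
    · exact zero_pow residueCard_pos.ne'
    · cases n - (m + j)
      · simp [teichmuller, pow_succ, pow_mul]
      · exact zero_pow residueCard_pos.ne'

/-- Used only for remainders of Teichmüller expansions, for which it matters how deep they lie and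
not what they are. -/
lemma uniformizer_pow_smul_mem (hπ : algebraMap O B π.1 = 0) (b : RamifiedWitt π B) (m j : ℕ) :
    ∃ c, π.1 ^ j • (verschiebung ^ m) b = (verschiebung ^ (m + j)) c := by
  induction j with
  | zero => exact ⟨b, by simp⟩
  | succ j ih =>
    obtain ⟨c, hc⟩ := ih
    refine ⟨c.frobeniusFun, ?_⟩
    rw [pow_succ', mul_smul, hc, uniformizer_smul hπ, ← add_assoc, pow_succ' verschiebung,
      Module.End.mul_apply, verschiebung_apply]
    congr 1
    ext n
    simp only [frobeniusFun, coeff_verschiebung_pow]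
    split_ifs
    · exact zero_pow residueCard_pos.ne'
    · rfl

end Verschiebung

end RamifiedWitt

namespace RamWitt
open IsLocalRing

/-! ### Uniformizers in a totally ramified extension. -/

section TotallyRamified

variable {O O' : Type*} [CommRing O] [IsDomain O] [IsDiscreteValuationRing O]
  [CommRing O'] [IsDomain O'] [IsDiscreteValuationRing O']
  [Algebra O O'] [IsLocalHom (algebraMap O O')]

lemma IsTotallyRamified.residueDegree_eq_one (h : IsTotallyRamified O O') :
    residueDegree O O' = 1 := by
  rw [residueDegree, ← (LinearEquiv.ofBijective (Algebra.linearMap (ResidueField O) (ResidueField O')) h).finrank_eq,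
    Module.finrank_self]

lemma IsTotallyRamified.residueCard_eq (h : IsTotallyRamified O O') :
    residueCard O' = residueCard O :=
  (Nat.card_congr (Equiv.ofBijective _ h)).symm

variable [Module.Finite O O'] [FaithfulSMul O O']

lemma IsTotallyRamified.coe_basis (h : IsTotallyRamified O O') {ϖ : O'} (hϖ : Irreducible ϖ) {e : ℕ}
    (he : Module.finrank O O' = e) : ⇑(h.basis hϖ he) = fun i : Fin e => ϖ ^ (i : ℕ) := by
  simp [basis]

lemma finrank_pos_of_finite {e : ℕ} (he : Module.finrank O O' = e) : 0 < e := by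
  have : Module.IsTorsionFree O O' := inferInstance
  rw [← he]
  exact Module.finrank_pos

/-- In a totally ramified extension of degree `e`, the uniformizer `π` of the base is a unit times
`ϖ ^ e`. -/
theorem IsTotallyRamified.exists_unit_mul_pow (h : IsTotallyRamified O O') {π : O}
    (hπ : Irreducible π) {ϖ : O'} (hϖ : Irreducible ϖ) {e : ℕ} (he : Module.finrank O O' = e) :
    ∃ η : O'ˣ, algebraMap O O' π = η * ϖ ^ e := by
  have hπ0 : algebraMap O O' π ≠ 0 :=
    (FaithfulSMul.algebraMap_eq_zero_iff O O').not.2 hπ.ne_zero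
  obtain ⟨m, η, hη⟩ := IsDiscreteValuationRing.eq_unit_mul_pow_irreducible hπ0 hϖ
  rw [hη]
  obtain rfl | hme | hme : m = e ∨ m < e ∨ e < m := by omega
  · exact ⟨η, rfl⟩
  · exfalso
    -- If `m < e`, then `ϖ ^ m = π η⁻¹` is a basis vector divisible by `π`, which is impossible.
    have hr : (h.basis hϖ he).repr (ϖ ^ m) ⟨m, hme⟩ = 1 := by
      rw [show ϖ ^ m = h.basis hϖ he ⟨m, hme⟩ by rw [h.coe_basis], Module.Basis.repr_self]
      simp
    have hs : ϖ ^ m = π • (↑η⁻¹ : O') := by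
      rw [Algebra.smul_def, hη, mul_right_comm, Units.mul_inv, one_mul]
    rw [hs, map_smul, Finsupp.smul_apply, smul_eq_mul] at hr
    exact hπ.not_isUnit (IsUnit.of_mul_eq_one _ hr)
  · exfalso
    have hs := (h.basis hϖ he).sum_repr (ϖ ^ e)
    set a := (h.basis hϖ he).repr (ϖ ^ e)
    have hdvd : ϖ ^ (e + 1) ∣ algebraMap O O' π := hη ▸ (pow_dvd_pow ϖ hme).mul_left _
    -- If `m > e`, expand `ϖ ^ e = ∑ a_i ϖ ^ i`. At the first unit `a_i` the term has valuation `i <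
    -- e`, while `ϖ ^ e` and all other terms have larger valuation: the later ones contain `ϖ ^ (i +
    -- 1)`, the earlier ones `π`. So `π` divides all `a_i`, and `ϖ ^ (e + 1)` would divide `ϖ ^ e`.
    have key : ∀ j ≤ e, ∀ i : Fin e, (i : ℕ) < j → π ∣ a i := by
      intro j
      induction j with
      | zero => intro _ i hi; omega
      | succ j ih =>
        intro hj i hi
        obtain hi | hi := Nat.lt_succ_iff_lt_or_eq.1 hi
        · exact ih (by omega) i hi
        by_contra hu
        have hu : IsUnit (a i) := by
          rw [← residue_ne_zero_iff_isUnit, Ne, residue_eq_zero_iff, hπ.maximalIdeal_eq,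
            Ideal.mem_span_singleton]
          exact hu
        have h1 : ϖ ^ (j + 1) ∣ a i • h.basis hϖ he i := by
          rw [← Finset.add_sum_erase _ _ (Finset.mem_univ i)] at hs
          rw [← (eq_sub_of_add_eq hs).symm]
          refine dvd_sub (pow_dvd_pow _ hj) (Finset.dvd_sum fun l hl => ?_)
          rw [h.coe_basis, Algebra.smul_def]
          obtain hlt | hlt := lt_or_gt_of_ne (Finset.ne_of_mem_erase hl)
          · obtain ⟨c, hc⟩ := ih (by omega) l (by omega)
            rw [hc, map_mul, mul_assoc]
            exact ((pow_dvd_pow _ (by omega)).trans hdvd).mul_right _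
          · exact (pow_dvd_pow _ (by omega)).mul_left _
        rw [h.coe_basis, Algebra.smul_def, (hu.map (algebraMap O O')).dvd_mul_left] at h1
        simp only [hi] at h1
        rw [pow_dvd_pow_iff hϖ.ne_zero hϖ.not_isUnit] at h1
        omega
    have h2 : ϖ ^ (e + 1) ∣ ϖ ^ e := by
      rw [← hs]
      refine Finset.dvd_sum fun i _ => ?_
      obtain ⟨c, hc⟩ := key e le_rfl i i.2
      rw [hc, Algebra.smul_def, map_mul, mul_assoc]
      exact hdvd.mul_right _
    rw [pow_dvd_pow_iff hϖ.ne_zero hϖ.not_isUnit] at h2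
    omega

end TotallyRamified

end RamWitt

namespace RamifiedWitt

open RamWitt MvPolynomial IsLocalRing

/-! ### The sums `∑_j η ^ ⌊j / e⌋ V ^ j [c_j]` as a triangular change of coordinates. -/

section Expansion

variable {O : Type*} [CommRing O] [IsDomain O] [IsDiscreteValuationRing O]
  [Finite (ResidueField O)] {ϖ : Uniformizer O} {A B : Type*} [CommRing A] [CommRing B]
  [Algebra O A] [Algebra O B] (η : Oˣ) (e : ℕ)

/-- The partial sums `∑_{j < m} η ^ ⌊j / e⌋ V ^ j [c_j]`. -/
noncomputable def partialSum (ϖ : Uniformizer O) (c : ℕ → B) (m : ℕ) : RamifiedWitt ϖ B :=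
  ∑ j ∈ Finset.range m, (η : O) ^ (j / e) • (verschiebung ^ j) (teichmuller ϖ (c j))

/-- The Witt components of the infinite sum `∑_j η ^ ⌊j / e⌋ V ^ j [c_j]`. -/
noncomputable def sumCoeff (ϖ : Uniformizer O) (c : ℕ → B) (m : ℕ) : B :=
  (partialSum η e ϖ c (m + 1)).coeff m

/-- Triangularity: the first summand involves only `c_j` with `j < m`, and the coefficient of `c_m`
is a unit. Bijectivity of `sumCoeff` over every algebra follows by recursion. -/
lemma sumCoeff_eq (c : ℕ → B) (m : ℕ) : sumCoeff η e ϖ c m =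
    (partialSum η e ϖ c m).coeff m + algebraMap O B (η ^ (m / e)) * c m := by
  rw [sumCoeff, partialSum, Finset.sum_range_succ, ← map_smul,
    (coeff_add_verschiebung_pow _ _ m).2, coeff_zero_smul]
  rfl

/-- The terms of index above `m` lie in the image of `V ^ (m + 1)` and leave component `m` alone, so
`sumCoeff` is the stable value of the partial sums. -/
lemma coeff_partialSum (c : ℕ → B) {m M : ℕ} (h : m < M) :
    (partialSum η e ϖ c M).coeff m = sumCoeff η e ϖ c m := by
  induction M, h using Nat.le_induction with
  | base => rfl
  | succ M hM ih =>
    rw [partialSum, Finset.sum_range_succ, ← map_smul,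
      (coeff_add_verschiebung_pow _ _ M).1 m hM]
    exact ih

lemma map_verschiebung_pow (φ : A →ₐ[O] B) (b : RamifiedWitt ϖ A) (m : ℕ) :
    map φ ((verschiebung ^ m) b) = (verschiebung ^ m) (map φ b) := by
  ext n
  rw [coeff_map, coeff_verschiebung_pow, coeff_verschiebung_pow]
  split_ifs
  · exact map_zero φ
  · rfl

lemma map_partialSum (φ : A →ₐ[O] B) (c : ℕ → A) (m : ℕ) :
    map φ (partialSum η e ϖ c m) = partialSum η e ϖ (fun j => φ (c j)) m := by
  simp only [partialSum, map_sum, map_smul, map_verschiebung_pow, map_teichmuller]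

lemma map_sumCoeff (φ : A →ₐ[O] B) (c : ℕ → A) (m : ℕ) :
    φ (sumCoeff η e ϖ c m) = sumCoeff η e ϖ (fun j => φ (c j)) m := by
  rw [sumCoeff, sumCoeff, ← map_partialSum, coeff_map]

lemma partialSum_congr {c d : ℕ → B} {m : ℕ} (h : ∀ j < m, c j = d j) :
    partialSum η e ϖ c m = partialSum η e ϖ d m :=
  Finset.sum_congr rfl fun j hj => by rw [h j (Finset.mem_range.1 hj)]

lemma sumCoeff_injective : Function.Injective (sumCoeff (B := B) η e ϖ) := by
  intro c d h
  funext m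
  induction m using Nat.strong_induction_on with
  | _ m ih =>
    have hm := congrFun h m
    rw [sumCoeff_eq, sumCoeff_eq, partialSum_congr η e ih, add_right_inj] at hm
    exact ((Units.isUnit (η ^ (m / e))).map (algebraMap O B)).mul_left_cancel (by simpa using hm)

lemma sumCoeff_surjective : Function.Surjective (sumCoeff (B := B) η e ϖ) := by
  intro w
  -- Solve `sumCoeff_eq` for `c_m` by well-founded recursion. The default `0` for `j ≥ m` is never
  -- read, since the partial sum of length `m` uses only indices below `m`.
  let f : (m : ℕ) → ((j : ℕ) → j < m → B) → B := fun m ih =>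
    algebraMap O B (η⁻¹ ^ (m / e) : Oˣ) * (w m - (partialSum η e ϖ
      (fun j => if hj : j < m then ih j hj else 0) m).coeff m)
  let c : ℕ → B := fun m => Nat.lt_wfRel.wf.fix f m
  have hc : ∀ m, c m = algebraMap O B (η⁻¹ ^ (m / e) : Oˣ) *
      (w m - (partialSum η e ϖ c m).coeff m) := by
    intro m
    refine (Nat.lt_wfRel.wf.fix_eq f m).trans ?_
    simp only [f]
    rw [partialSum_congr η e (d := c) fun j hj => dif_pos hj]
  refine ⟨c, funext fun m => ?_⟩
  rw [sumCoeff_eq, hc m, ← mul_assoc, ← map_mul, ← Units.val_pow_eq_pow_val, ← Units.val_mul,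
    ← mul_pow, mul_inv_cancel, one_pow, Units.val_one, map_one, one_mul, add_sub_cancel]

lemma sumCoeff_zero : sumCoeff (B := B) η e ϖ 0 = 0 := by
  have h : teichmuller ϖ (0 : B) = 0 := by
    ext n
    rw [coeff_zero_eq]
    cases n <;> rfl
  funext m
  simp [sumCoeff, partialSum, h, coeff_zero_eq]

end Expansion

/-! ### Drinfeld's homomorphism in Teichmüller coordinates. -/

section Drinfeld

variable {O O' : Type*} [CommRing O] [IsDomain O] [IsDiscreteValuationRing O]
  [CommRing O'] [IsDomain O'] [IsDiscreteValuationRing O']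
  [Algebra O O'] [IsLocalHom (algebraMap O O')]
  [Finite (ResidueField O)] [Finite (ResidueField O')]
  {B : Type*} [CommRing B] [Algebra O B] [Algebra O' B] [IsScalarTower O O' B]
  {π : Uniformizer O} (ϖ : Uniformizer O')

lemma ghost_drinfeld (h : IsTotallyRamified O O') (b : RamifiedWitt π B) (n : ℕ) :
    (drinfeld ϖ b).ghost n = b.ghost n := by
  refine (ghost_drinfeldFun ϖ b n).trans ?_
  rw [h.residueDegree_eq_one, one_mul]

/-- Both sides have ghost components `b ^ q ^ n`, because the two residue fields have the same
cardinality. -/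
lemma drinfeld_teichmuller (h : IsTotallyRamified O O') (b : B) :
    drinfeld ϖ (teichmuller π b) = teichmuller ϖ b := by
  have key : drinfeld ϖ (teichmuller π (X () : MvPolynomial Unit O')) = teichmuller ϖ (X ()) :=
    ghost_ext isLeftRegular_algebraMap fun n => by
      rw [ghost_drinfeld ϖ h, ghost_teichmuller, ghost_teichmuller, h.residueCard_eq]
  have := congrArg (map (aeval fun _ => b)) key
  rwa [← drinfeld_map, map_teichmuller, map_teichmuller, AlgHom.restrictScalars_apply,
    aeval_X] at this

/-- Ramification enters here: a shift multiplies ghost components by `π` on one side and by `ϖ` on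
the other, and `ρ = π / ϖ` makes up the difference. -/
lemma drinfeld_shift (h : IsTotallyRamified O O') {ρ : O'}
    (hρ : algebraMap O O' π.1 = ρ * ϖ.1) (b : RamifiedWitt π B) :
    drinfeld ϖ b.shift = ρ • (drinfeld ϖ b).shift := by
  have key : drinfeld ϖ (univ π O' (Fin 1) 0).shift =
      ρ • (drinfeld ϖ (univ π O' (Fin 1) 0)).shift :=
    ghost_ext isLeftRegular_algebraMap fun n => by
      rw [ghost_drinfeld ϖ h, ghost_smul]
      cases n with
      | zero => rw [ghost_shift_zero, ghost_shift_zero, mul_zero]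
      | succ n =>
        rw [ghost_shift_succ, ghost_shift_succ, ghost_drinfeld ϖ h, ← mul_assoc, ← map_mul, ← hρ,
          ← IsScalarTower.algebraMap_apply]
  have hb := map_univ (R := O') ![b] 0
  have := congrArg (map (aeval (R := O') fun p : Fin 1 × ℕ => (![b] p.1).coeff p.2)) key
  rw [map_smul, map_shift, ← drinfeld_map, ← drinfeld_map, map_shift, hb] at this
  exact this

lemma drinfeld_verschiebung_pow (h : IsTotallyRamified O O') {ρ : O'}
    (hρ : algebraMap O O' π.1 = ρ * ϖ.1) (b : RamifiedWitt π B) (m : ℕ) :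
    drinfeld ϖ ((verschiebung ^ m) b) = ρ ^ m • (verschiebung ^ m) (drinfeld ϖ b) := by
  induction m with
  | zero => simp
  | succ m ih =>
    rw [pow_succ', Module.End.mul_apply, verschiebung_apply, drinfeld_shift ϖ h hρ, ih, shift_smul,
      smul_smul, pow_succ' ρ, pow_succ' verschiebung, Module.End.mul_apply, verschiebung_apply]

/-- The exponents of the powers of `X_{n, i}` of which `u ⊗ id` is a function on special fibres. -/
noncomputable def frobeniusPower (O : Type*) [CommRing O] [IsLocalRing O] {e : ℕ}
    (p : ℕ × Fin e) : ℕ :=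
  Nat.card (ResidueField O) ^ (p.1 * (e - 1) + p.2)

lemma sum_range_mul_eq {M : Type*} [AddCommMonoid M] (e N : ℕ) (f : ℕ → M) :
    ∑ j ∈ Finset.range (N * e), f j =
      ∑ i : Fin e, ∑ n ∈ Finset.range N, f (n * e + i) := by
  rw [Finset.sum_comm]
  induction N with
  | zero => simp
  | succ N ih =>
    rw [Finset.sum_range_succ, add_one_mul, Finset.sum_range_add, ih,
      Fin.sum_univ_eq_sum_range fun i => f (N * e + i)]

/-- The central formula. The term `V ^ n [x]` of `b i` contributes `η ^ n ϖ ^ (n (e - 1) + i) V ^ n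
[x]`, and the power of `ϖ` becomes further shifts and `q`-th powers. The total shift is `n + n (e -
1) + i = n e + i`, so the `e` expansions interleave without overlap. -/
theorem coeff_sum_drinfeld_mul (h : IsTotallyRamified O O') (η : O'ˣ) {e : ℕ} (he : 0 < e)
    (hη : algebraMap O O' π.1 = η * ϖ.1 ^ e) (hB : algebraMap O' B ϖ.1 = 0)
    (b : Fin e → RamifiedWitt π B) (c : ℕ → B)
    (hc : ∀ n (i : Fin e), c (n * e + i) = (b i).coeff n ^ frobeniusPower O (n, i)) (m : ℕ) :
    (∑ i : Fin e, ϖ.1 ^ (i : ℕ) • drinfeld ϖ (b i)).coeff m = sumCoeff η e ϖ c m := by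
  -- With `N = m + 1` terms of each expansion, the remainders lie in the image of `V ^ (N e)`, and
  -- `m < N e` since `e ≥ 1`.
  set N := m + 1
  have hρ : algebraMap O O' π.1 = (η * ϖ.1 ^ (e - 1)) * ϖ.1 := by
    rw [hη, mul_assoc, ← pow_succ, Nat.sub_add_cancel he]
  have hm : m < N * e := Nat.lt_of_lt_of_le m.lt_succ_self (Nat.le_mul_of_pos_right _ he)
  have key : ∀ i : Fin e, ∃ y, ϖ.1 ^ (i : ℕ) • drinfeld ϖ (b i) =
      ∑ n ∈ Finset.range N, (η : O') ^ ((n * e + i) / e) •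
        (verschiebung ^ (n * e + i)) (teichmuller ϖ (c (n * e + i))) +
      (verschiebung ^ (N * e)) y := by
    intro i
    obtain ⟨y, hy⟩ := uniformizer_pow_smul_mem hB
      (drinfeld ϖ (⟨fun n => (b i).coeff (N + n)⟩ : RamifiedWitt π B)) N (N * (e - 1) + i)
    -- The remainder is `η ^ N ϖ ^ (N (e - 1) + i) V ^ N (…) = η ^ N V ^ (N e + i) y`; the surplus
    -- `V ^ i` goes into the witness.
    refine ⟨(η : O') ^ N • (verschiebung ^ (i : ℕ)) y, ?_⟩
    conv_lhs => rw [(b i).eq_sum_add_verschiebung_pow N]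
    rw [map_add, map_sum, smul_add, Finset.smul_sum]
    congr 1
    · refine Finset.sum_congr rfl fun n _ => ?_
      rw [drinfeld_verschiebung_pow ϖ h hρ, drinfeld_teichmuller ϖ h, smul_smul, mul_pow, ← pow_mul,
        mul_left_comm, ← pow_add, mul_smul, uniformizer_pow_smul_teichmuller hB, hc,
        h.residueCard_eq]
      have h1 : (n * e + i) / e = n := by
        rw [mul_comm, Nat.mul_add_div he, Nat.div_eq_of_lt i.2, add_zero]
      have h2 : n + (i + (e - 1) * n) = n * e + i := by
        obtain ⟨e, rfl⟩ := Nat.exists_eq_add_of_lt he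
        simp
        ring
      rw [h1, h2, frobeniusPower, mul_comm (e - 1), add_comm (i : ℕ)]
    · rw [drinfeld_verschiebung_pow ϖ h hρ, smul_smul, mul_pow, ← pow_mul,
        mul_left_comm, ← pow_add, mul_smul, mul_comm (e - 1), add_comm (i : ℕ), hy, map_smul]
      congr 1
      rw [← Module.End.mul_apply, ← pow_add]
      congr 2
      obtain ⟨e, rfl⟩ := Nat.exists_eq_add_of_lt he
      simp
      ring
  choose y hy using key
  simp only [hy]
  rw [Finset.sum_add_distrib, ← map_sum,
    ← sum_range_mul_eq e N fun j => (η : O') ^ (j / e) •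
        (verschiebung ^ j) (teichmuller ϖ (c j)),
    (coeff_add_verschiebung_pow _ _ _).1 m hm]
  exact coeff_partialSum η e c hm

end Drinfeld

end RamifiedWitt

namespace RamWitt

/-! ### Group objects that represent presheaves of groups. -/

section RepresentedGroups

open CategoryTheory Limits Opposite MonObj

universe v u

variable {C : Type u} [Category.{v} C] [CartesianMonoidalCategory C]

/-- The group object given by an object that represents a presheaf of groups. -/
def grpOfRepresentableBy (P : Cᵒᵖ ⥤ GrpCat.{v}) {X : C} (α : (P ⋙ forget _).RepresentableBy X) :
    Grp C :=
  letI := GrpObj.ofRepresentableBy X P α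
  ⟨X⟩

section

variable {P Q R : Cᵒᵖ ⥤ GrpCat.{v}} {X Y Z : C} (α : (P ⋙ forget _).RepresentableBy X)
  (β : (Q ⋙ forget _).RepresentableBy Y) (δ : (R ⋙ forget _).RepresentableBy Z)

/-- The presheaf of groups represented by `grpOfRepresentableBy P α` is `P`. -/
noncomputable def yonedaIso : yonedaGrp.obj (grpOfRepresentableBy P α) ≅ P :=
  yonedaGrpObjIsoOfRepresentableBy X P α

/-- The homomorphism of group objects given by a morphism of the presheaves represented by them. -/
noncomputable def grpHomOfRepresentableBy (φ : P ⟶ Q) :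
    grpOfRepresentableBy P α ⟶ grpOfRepresentableBy Q β :=
  yonedaGrpFullyFaithful.preimage ((yonedaIso α).hom ≫ φ ≫ (yonedaIso β).inv)

lemma map_grpHomOfRepresentableBy (φ : P ⟶ Q) : yonedaGrp.map (grpHomOfRepresentableBy α β φ) =
    (yonedaIso α).hom ≫ φ ≫ (yonedaIso β).inv :=
  yonedaGrpFullyFaithful.map_preimage _

lemma grpHomOfRepresentableBy_id : grpHomOfRepresentableBy α α (𝟙 P) = 𝟙 _ :=
  yonedaGrp.map_injective (by simp [map_grpHomOfRepresentableBy])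

lemma grpHomOfRepresentableBy_comp (φ : P ⟶ Q) (ψ : Q ⟶ R) : grpHomOfRepresentableBy α δ (φ ≫ ψ) =
    grpHomOfRepresentableBy α β φ ≫ grpHomOfRepresentableBy β δ ψ :=
  yonedaGrp.map_injective (by simp [map_grpHomOfRepresentableBy])

/-- The Yoneda description of the homomorphism, evaluated at a point `f`; through it, later
identities between morphisms of group objects become identities between points. -/
lemma homEquiv_comp_grpHomOfRepresentableBy (φ : P ⟶ Q) {T : C} (f : T ⟶ X) :
    β.homEquiv (f ≫ (grpHomOfRepresentableBy α β φ).hom.hom) = φ.app (op T) (α.homEquiv f) := by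
  have h := congrArg (fun t => (t.app (op T)).hom f)
    ((Iso.comp_inv_eq _).1 ((Category.assoc _ _ _).trans (map_grpHomOfRepresentableBy α β φ).symm))
  exact h.symm

lemma homEquiv_comp_zero (H : Grp C) {T : C} (f : T ⟶ H.X) :
    β.homEquiv (f ≫ (0 : H ⟶ grpOfRepresentableBy Q β).hom.hom) = (1 : Q.obj (op T)) := by
  have h : f ≫ (0 : H ⟶ grpOfRepresentableBy Q β).hom.hom = (1 : T ⟶ (grpOfRepresentableBy Q β).X) := by
    change f ≫ CartesianMonoidalCategory.toUnit _ ≫ η = CartesianMonoidalCategory.toUnit _ ≫ η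
    rw [← Category.assoc, CartesianMonoidalCategory.comp_toUnit]
  exact (congrArg β.homEquiv h).trans ((yonedaIso β).hom.app (op T)).hom.map_one

end

/-- A diagram of group objects that represent the presheaves of groups of a given diagram. -/
noncomputable def grpDiagram {J : Type*} [Category J] (Φ : J ⥤ Cᵒᵖ ⥤ GrpCat.{v}) {X : J → C}
    (α : ∀ j, (Φ.obj j ⋙ forget _).RepresentableBy (X j)) : J ⥤ Grp C where
  obj j := grpOfRepresentableBy (Φ.obj j) (α j)
  map f := grpHomOfRepresentableBy _ _ (Φ.map f)
  map_id j := by rw [Φ.map_id, grpHomOfRepresentableBy_id]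
  map_comp f g := by rw [Φ.map_comp, grpHomOfRepresentableBy_comp (α _) (α _)]

/-- The forgetful functor from group objects reflects limits. -/
lemma reflectsLimitsOfShape_forget (J : Type v) [SmallCategory J] :
    ReflectsLimitsOfShape J (Grp.forget C) where
  reflectsLimit {K} := ⟨fun {c} hc => by
    -- The Yoneda embedding carries the limit of underlying objects to presheaves of sets. It is
    -- then reflected, first to presheaves of groups, and from there to group objects, because
    -- `yonedaGrp` is fully faithful.
    have h1 : PreservesLimitsOfShape J (yoneda (C := C)) := inferInstance
    have h2 : IsLimit ((yonedaGrp ⋙ (Functor.whiskeringRight _ _ _).obj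
      (CategoryTheory.forget GrpCat.{v})).mapCone c) :=
      isLimitOfPreserves (yoneda (C := C)) hc
    have h3 : ReflectsLimitsOfShape J ((Functor.whiskeringRight Cᵒᵖ _ _).obj
      (CategoryTheory.forget GrpCat.{v})) := inferInstance
    have h4 : IsLimit (yonedaGrp.mapCone c) :=
      isLimitOfReflects ((Functor.whiskeringRight Cᵒᵖ _ _).obj (CategoryTheory.forget GrpCat.{v})) h2
    exact ⟨isLimitOfReflects yonedaGrp h4⟩⟩

end RepresentedGroups

end RamWitt

namespace RamWitt

/-! ### Kernels cut out by powers of coordinates: points and truncations. -/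

section PowerKernels

open CategoryTheory Limits Opposite

universe v

variable {R : Type v} [CommRing R] {F G : CommAlgCat.{v} R ⥤ CommRingCat.{v}} {σ : Type}

namespace Coordinates

variable (c : Coordinates F σ) (α : F ⟶ G) (δ : σ → ℕ)

/-- The kernel of the homomorphism `α` on `B`-valued points. -/
def pointKernel (B : CommAlgCat.{v} R) : AddSubgroup (F.obj B) :=
  (α.app B).hom.toAddMonoidHom.ker

/-- The vectors with vanishing difference in the coordinates in `S` are those which agree in these
coordinates. -/
def IsTruncation (S : Set σ) : Prop :=
  ∀ (B : CommAlgCat.{v} R) (x y : F.obj B),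
    (∀ p ∈ S, c.equiv B (x - y) p = 0) ↔ ∀ p ∈ S, c.equiv B x p = c.equiv B y p

/-- The sets of coordinates to which the group structure can be restricted. -/
abbrev Truncation := {S : Set σ // c.IsTruncation S}

variable {c}

/-- The subgroup of the vectors with vanishing coordinates in `S`. -/
def vanishing (S : c.Truncation) (B : CommAlgCat.{v} R) : AddSubgroup (F.obj B) where
  carrier := {x | ∀ p ∈ S.1, c.equiv B x p = 0}
  zero_mem' := by
    have := (S.2 B 0 0).2 fun _ _ => rfl
    rwa [sub_zero] at this
  add_mem' {x y} hx hy := by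
    have h0 : ∀ p ∈ S.1, c.equiv B 0 p = 0 := by
      have := (S.2 B 0 0).2 fun _ _ => rfl
      rwa [sub_zero] at this
    -- `IsTruncation` speaks only of differences, so a sum is treated as `x - (0 - y)`.
    have hn := (S.2 B 0 y).2 fun p hp => (h0 p hp).trans (hy p hp).symm
    have := (S.2 B x (0 - y)).2 fun p hp => (hx p hp).trans (hn p hp).symm
    rwa [zero_sub, sub_neg_eq_add] at this
  neg_mem' {x} hx := by
    have h0 : ∀ p ∈ S.1, c.equiv B 0 p = 0 := by
      have := (S.2 B 0 0).2 fun _ _ => rfl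
      rwa [sub_zero] at this
    have := (S.2 B 0 x).2 fun p hp => (h0 p hp).trans (hx p hp).symm
    rwa [zero_sub] at this

/-- The truncation to the coordinates in `S` of the kernel of `α` on `B`-valued points. -/
abbrev TruncKernel (S : c.Truncation) (B : CommAlgCat.{v} R) :=
  pointKernel α B ⧸ (vanishing S B).addSubgroupOf (pointKernel α B)

/-- Functoriality of the kernels. -/
def pointKernelMap {B C : CommAlgCat.{v} R} (φ : B ⟶ C) : pointKernel α B →+ pointKernel α C :=
  ((F.map φ).hom.toAddMonoidHom.comp (pointKernel α B).subtype).codRestrict _ fun x => by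
    have h : α.app C (F.map φ x.1) = G.map φ (α.app B x.1) := by
      rw [← ConcreteCategory.comp_apply, α.naturality]; rfl
    have hx : α.app B x.1 = 0 := x.2
    rw [hx, map_zero] at h
    exact h

/-- Functoriality of the truncated kernels. -/
def truncMap {S S' : c.Truncation} (hS : S' ≤ S) {B C : CommAlgCat.{v} R} (φ : B ⟶ C) :
    TruncKernel α S B →+ TruncKernel α S' C :=
  QuotientAddGroup.map _ _ (pointKernelMap α φ) fun x hx p hp =>
    (c.naturality φ x.1 p).trans ((congrArg φ.hom (hx p (hS hp))).trans (map_zero _))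

open Classical in
/-- The coordinates of an element of the truncated kernel, extended by zero. -/
noncomputable def truncCoord (S : c.Truncation) (B : CommAlgCat.{v} R) :
    TruncKernel α S B → σ → B :=
  Quotient.lift (fun x p => if p ∈ S.1 then c.equiv B x.1 p else 0) fun x y h => by
    have h : -x + y ∈ (vanishing S B).addSubgroupOf (pointKernel α B) :=
      QuotientAddGroup.leftRel_apply.1 h
    rw [neg_add_eq_sub] at h
    funext p
    split_ifs with hp
    · exact ((S.2 B y.1 x.1).1 h p hp).symm
    · rfl

lemma truncCoord_mk_of_mem (S : c.Truncation) (B : CommAlgCat.{v} R) (x : pointKernel α B) {p : σ}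
    (hp : p ∈ S.1) : truncCoord α S B (QuotientAddGroup.mk x) p = c.equiv B x.1 p :=
  if_pos hp

lemma truncCoord_of_notMem (S : c.Truncation) (B : CommAlgCat.{v} R) (x : TruncKernel α S B) {p : σ}
    (hp : p ∉ S.1) : truncCoord α S B x p = 0 := by
  obtain ⟨x, rfl⟩ := QuotientAddGroup.mk_surjective x
  exact if_neg hp

lemma truncCoord_injective (S : c.Truncation) (B : CommAlgCat.{v} R) :
    Function.Injective (truncCoord α S B) := by
  intro x y h
  obtain ⟨x, rfl⟩ := QuotientAddGroup.mk_surjective x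
  obtain ⟨y, rfl⟩ := QuotientAddGroup.mk_surjective y
  rw [QuotientAddGroup.eq, neg_add_eq_sub]
  refine (S.2 B y.1 x.1).2 fun p hp => ?_
  have := congrFun h p
  rw [truncCoord_mk_of_mem α S B _ hp, truncCoord_mk_of_mem α S B _ hp] at this
  exact this.symm

lemma truncCoord_truncMap {S S' : c.Truncation} (hS : S' ≤ S) {B C : CommAlgCat.{v} R} (φ : B ⟶ C)
    (x : TruncKernel α S B) {p : σ} (hp : p ∈ S'.1) :
    truncCoord α S' C (truncMap α hS φ x) p = φ.hom (truncCoord α S B x p) := by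
  obtain ⟨x, rfl⟩ := QuotientAddGroup.mk_surjective x
  rw [truncCoord_mk_of_mem α S B _ (hS hp)]
  exact (truncCoord_mk_of_mem α S' C (pointKernelMap α φ x) hp).trans (c.naturality φ x.1 p)

lemma truncCoord_ext {S : c.Truncation} {B : CommAlgCat.{v} R} {x y : TruncKernel α S B}
    (h : ∀ p ∈ S.1, truncCoord α S B x p = truncCoord α S B y p) : x = y := by
  refine truncCoord_injective α S B (funext fun p => ?_)
  by_cases hp : p ∈ S.1
  · exact h p hp
  · rw [truncCoord_of_notMem α S B _ hp, truncCoord_of_notMem α S B _ hp]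

lemma truncMap_id (S : c.Truncation) (B : CommAlgCat.{v} R) (x : TruncKernel α S B) :
    truncMap α (le_refl S) (𝟙 B) x = x :=
  truncCoord_ext α fun _ hp => truncCoord_truncMap α _ _ x hp

lemma truncMap_truncMap {S S' S'' : c.Truncation} (hS : S' ≤ S) (hS' : S'' ≤ S')
    {B C D : CommAlgCat.{v} R} (φ : B ⟶ C) (ψ : C ⟶ D) (x : TruncKernel α S B) :
    truncMap α hS' ψ (truncMap α hS φ x) = truncMap α (hS'.trans hS) (φ ≫ ψ) x :=
  truncCoord_ext α fun _ hp => by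
    rw [truncCoord_truncMap α _ _ _ hp, truncCoord_truncMap α _ _ _ (hS' hp),
      truncCoord_truncMap α _ _ _ hp]
    rfl

/-- A truncated kernel as a presheaf of groups. -/
def truncPresheafObj (S : c.Truncation) : (CommAlgCat.{v} R)ᵒᵖᵒᵖ ⥤ GrpCat.{v} where
  obj B := GrpCat.of (Multiplicative (TruncKernel α S B.unop.unop))
  map φ := GrpCat.ofHom (AddMonoidHom.toMultiplicative (truncMap α le_rfl φ.unop.unop))
  map_id _ := GrpCat.hom_ext <| MonoidHom.ext fun x => truncMap_id α _ _ x
  map_comp φ ψ := GrpCat.hom_ext <| MonoidHom.ext fun x =>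
    (truncMap_truncMap α le_rfl le_rfl φ.unop.unop ψ.unop.unop x).symm

/-- The truncation morphisms between the truncated kernels. -/
def truncPresheafMap {S S' : c.Truncation} (h : S' ≤ S) :
    truncPresheafObj α S ⟶ truncPresheafObj α S' where
  app B := GrpCat.ofHom (AddMonoidHom.toMultiplicative (truncMap α h (𝟙 B.unop.unop)))
  naturality B C φ := GrpCat.hom_ext <| MonoidHom.ext fun x => by
    refine (truncMap_truncMap α le_rfl h φ.unop.unop (𝟙 C.unop.unop) x).trans ?_
    refine Eq.trans ?_ (truncMap_truncMap α h le_rfl (𝟙 B.unop.unop) φ.unop.unop x).symm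
    rw [Category.comp_id, Category.id_comp]

/-- The truncated kernels as presheaves of groups. -/
def truncPresheaf : (c.Truncation)ᵒᵖ ⥤ (CommAlgCat.{v} R)ᵒᵖᵒᵖ ⥤ GrpCat.{v} where
  obj S := truncPresheafObj α S.unop
  map f := truncPresheafMap α (leOfHom f.unop)
  map_id _ := NatTrans.ext <| funext fun _ => GrpCat.hom_ext <| MonoidHom.ext fun x =>
    truncMap_id α _ _ x
  map_comp {S S' S''} f g := NatTrans.ext <| funext fun B => GrpCat.hom_ext <|
    MonoidHom.ext fun x => by
      refine Eq.trans ?_ (truncMap_truncMap α (leOfHom f.unop) (leOfHom g.unop)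
        (𝟙 B.unop.unop) (𝟙 B.unop.unop) x).symm
      rw [Category.comp_id]
      rfl

/-- The kernel of `α` is defined by the vanishing of powers of the coordinates. -/
structure IsPowerKernel : Prop where
  pos (p : σ) : 0 < δ p
  zero_iff (B : CommAlgCat.{v} R) (x : F.obj B) :
    α.app B x = 0 ↔ ∀ p, c.equiv B x p ^ δ p = 0

open Classical in
/-- The exponents that define the coordinate ring of a truncated kernel. -/
noncomputable def truncExponent (S : Set σ) (p : σ) : ℕ := if p ∈ S then δ p else 1

/-- The ring `R[X_p] / (X_p ^ δ_p)`. -/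
abbrev PowerQuotient (R : Type v) [CommRing R] (δ : σ → ℕ) : Type v :=
  MvPolynomial σ R ⧸ Ideal.span (Set.range fun p => (MvPolynomial.X p : MvPolynomial σ R) ^ δ p)

/-- The image of the variable `X_p`. -/
noncomputable def PowerQuotient.x (R : Type v) [CommRing R] (δ : σ → ℕ) (p : σ) : PowerQuotient R δ :=
  Ideal.Quotient.mk _ (MvPolynomial.X p)

lemma PowerQuotient.x_pow (p : σ) : PowerQuotient.x R δ p ^ δ p = 0 := by
  rw [x, ← map_pow, Ideal.Quotient.eq_zero_iff_mem]
  exact Ideal.subset_span ⟨p, rfl⟩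

variable {δ} in
lemma PowerQuotient.algHom_ext {B : Type v} [CommRing B] [Algebra R B]
    {f g : PowerQuotient R δ →ₐ[R] B} (h : ∀ p, f (x R δ p) = g (x R δ p)) : f = g :=
  Ideal.Quotient.algHom_ext R (MvPolynomial.algHom_ext h)

variable {δ} in
/-- Homomorphisms from `R[X_p] / (X_p ^ δ_p)`. -/
noncomputable def PowerQuotient.lift {B : Type v} [CommRing B] [Algebra R B] (b : σ → B)
    (hb : ∀ p, b p ^ δ p = 0) : PowerQuotient R δ →ₐ[R] B :=
  Ideal.Quotient.liftₐ _ (MvPolynomial.aeval b) fun a ha => by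
    have : Ideal.span (Set.range fun p => (MvPolynomial.X p : MvPolynomial σ R) ^ δ p) ≤
        RingHom.ker (MvPolynomial.aeval (R := R) b) := by
      rw [Ideal.span_le]
      rintro _ ⟨p, rfl⟩
      simp [RingHom.mem_ker, hb]
    exact this ha

@[simp]
lemma PowerQuotient.lift_x {B : Type v} [CommRing B] [Algebra R B] (b : σ → B)
    (hb : ∀ p, b p ^ δ p = 0) (p : σ) : PowerQuotient.lift b hb (x R δ p) = b p :=
  (Ideal.Quotient.liftₐ_apply _ _ _ _).trans (MvPolynomial.aeval_X b p)

variable {α δ}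

/-- Inside `S` these are the equations of the kernel. Outside `S` the exponent `1` matches the
extension by zero, so that all truncations have variables indexed by the same `σ`. -/
lemma truncCoord_pow (hα : IsPowerKernel (c := c) α δ) (S : c.Truncation) (B : CommAlgCat.{v} R)
    (x : TruncKernel α S B) (p : σ) : truncCoord α S B x p ^ truncExponent δ S.1 p = 0 := by
  rw [truncExponent]
  split_ifs with hp
  · obtain ⟨x, rfl⟩ := QuotientAddGroup.mk_surjective x
    rw [truncCoord_mk_of_mem α S B x hp]
    exact (hα.zero_iff B x.1).1 x.2 p
  · rw [pow_one, truncCoord_of_notMem α S B x hp]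

/-- Extension by zero lifts a truncated solution to a point of the full kernel, since `0 ^ δ p = 0`
for `δ p > 0`. Hence the naive quotients of groups of points are already representable. -/
lemma exists_truncCoord_eq (hα : IsPowerKernel (c := c) α δ) (S : c.Truncation)
    (B : CommAlgCat.{v} R) (b : σ → B) (hb : ∀ p, b p ^ truncExponent δ S.1 p = 0) :
    ∃ x, truncCoord α S B x = b := by
  have h : (c.equiv B).symm b ∈ pointKernel α B := (hα.zero_iff B _).2 fun p => by
    rw [Equiv.apply_symm_apply]
    have := hb p
    rw [truncExponent] at this
    split_ifs at this with hp
    · exact this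
    · rw [pow_one] at this
      rw [this, zero_pow (hα.pos p).ne']
  refine ⟨QuotientAddGroup.mk ⟨_, h⟩, funext fun p => ?_⟩
  by_cases hp : p ∈ S.1
  · rw [truncCoord_mk_of_mem α S B _ hp, Equiv.apply_symm_apply]
  · have := hb p
    rw [truncExponent, if_neg hp, pow_one] at this
    rw [truncCoord_of_notMem α S B _ hp, this]

/-- The element of the truncated kernel with given coordinates. -/
noncomputable def ofTruncCoord (hα : IsPowerKernel (c := c) α δ) (S : c.Truncation)
    (B : CommAlgCat.{v} R) (f : PowerQuotient R (truncExponent δ S.1) →ₐ[R] B) :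
    TruncKernel α S B :=
  (exists_truncCoord_eq hα S B (fun p => f (PowerQuotient.x R _ p)) fun p => by
    rw [← map_pow, PowerQuotient.x_pow, map_zero]).choose

lemma truncCoord_ofTruncCoord (hα : IsPowerKernel (c := c) α δ) (S : c.Truncation)
    (B : CommAlgCat.{v} R) (f : PowerQuotient R (truncExponent δ S.1) →ₐ[R] B) (p : σ) :
    truncCoord α S B (ofTruncCoord hα S B f) p = f (PowerQuotient.x R _ p) :=
  congrFun (exists_truncCoord_eq hα S B (fun p => f (PowerQuotient.x R _ p)) fun p => by
    rw [← map_pow, PowerQuotient.x_pow, map_zero]).choose_spec p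

/-- Points of the truncated kernel as homomorphisms. -/
noncomputable def truncHomEquiv (hα : IsPowerKernel (c := c) α δ) (S : c.Truncation)
    (B : CommAlgCat.{v} R) :
    (PowerQuotient R (truncExponent δ S.1) →ₐ[R] B) ≃ TruncKernel α S B where
  toFun := ofTruncCoord hα S B
  invFun x := PowerQuotient.lift (truncCoord α S B x) (truncCoord_pow hα S B x)
  left_inv f := PowerQuotient.algHom_ext fun p => by
    rw [PowerQuotient.lift_x, truncCoord_ofTruncCoord]
  right_inv x := truncCoord_ext α fun p _ => by
    rw [truncCoord_ofTruncCoord, PowerQuotient.lift_x]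

/-- The truncated kernels are represented by the rings `R[X_p] / (X_p ^ δ_p)`, with the variables
outside of `S` omitted. -/
noncomputable def truncRepresentableBy (hα : IsPowerKernel (c := c) α δ) (S : (c.Truncation)ᵒᵖ) :
    ((truncPresheaf α).obj S ⋙ forget _).RepresentableBy
      (op (CommAlgCat.of R (PowerQuotient R (truncExponent δ S.unop.1)))) where
  homEquiv {T} := ⟨fun f => truncHomEquiv hα S.unop T.unop f.unop.hom,
    fun x => (CommAlgCat.ofHom ((truncHomEquiv hα S.unop T.unop).symm x)).op,
    fun f => by
      apply Quiver.Hom.unop_inj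
      ext : 1
      exact (truncHomEquiv hα S.unop T.unop).symm_apply_apply f.unop.hom,
    fun x => (truncHomEquiv hα S.unop T.unop).apply_symm_apply x⟩
  homEquiv_comp {T T'} f g := by
    refine truncCoord_ext (S := S.unop) (B := T.unop) α fun p hp => ?_
    refine (truncCoord_ofTruncCoord hα S.unop T.unop _ p).trans ?_
    refine Eq.trans ?_ (truncCoord_truncMap α (le_refl S.unop) f.unop _ hp).symm
    refine congrArg f.unop.hom ?_
    exact (truncCoord_ofTruncCoord hα S.unop T'.unop _ p).symm

lemma truncCoord_homEquiv (hα : IsPowerKernel (c := c) α δ) (S : (c.Truncation)ᵒᵖ)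
    {T : (CommAlgCat.{v} R)ᵒᵖ}
    (f : T ⟶ op (CommAlgCat.of R (PowerQuotient R (truncExponent δ S.unop.1)))) (p : σ) :
    truncCoord α S.unop T.unop (Multiplicative.toAdd ((truncRepresentableBy hα S).homEquiv f)) p =
      f.unop.hom (PowerQuotient.x R _ p) :=
  truncCoord_ofTruncCoord hα S.unop T.unop _ p

end Coordinates

end PowerKernels

end RamWitt

namespace RamWitt

/-! ### The full truncation as the kernel of the homomorphism of group objects. -/

section PowerKernels

open CategoryTheory Limits Opposite

universe v

variable {R : Type v} [CommRing R] {F G : CommAlgCat.{v} R ⥤ CommRingCat.{v}} {σ τ : Type}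

namespace Coordinates

variable {c : Coordinates F σ} {α : F ⟶ G} {δ : σ → ℕ}

variable (α) in
/-- The inclusion of the kernel of `α`, for the truncation which omits no coordinate. -/
def truncInclusion (S : c.Truncation) (hS : ∀ p, p ∈ S.1) :
    truncPresheafObj α S ⟶ presheaf F where
  app B := GrpCat.ofHom (AddMonoidHom.toMultiplicative
    (QuotientAddGroup.lift _ (pointKernel α B.unop.unop).subtype fun x hx => by
      have hx : ∀ p ∈ S.1, c.equiv _ x.1 p = 0 := hx
      refine (c.equiv _).injective (funext fun p => (S.2 _ x.1 0).1 ?_ p (hS p))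
      rwa [sub_zero]))
  naturality B C φ := GrpCat.hom_ext <| MonoidHom.ext fun x => by
    obtain ⟨x, rfl⟩ := QuotientAddGroup.mk_surjective (Multiplicative.toAdd x)
    rfl

lemma exists_truncInclusion_eq (S : c.Truncation) (hS : ∀ p, p ∈ S.1)
    (B : (CommAlgCat.{v} R)ᵒᵖᵒᵖ) (y : F.obj B.unop.unop) (hy : y ∈ pointKernel α B.unop.unop) :
    ∃ x, (truncInclusion α S hS).app B x = Multiplicative.ofAdd y :=
  ⟨Multiplicative.ofAdd (QuotientAddGroup.mk ⟨y, hy⟩), rfl⟩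

lemma truncInclusion_mem (S : c.Truncation) (hS : ∀ p, p ∈ S.1)
    (B : (CommAlgCat.{v} R)ᵒᵖᵒᵖ) (x) :
    Multiplicative.toAdd ((truncInclusion α S hS).app B x) ∈ pointKernel α B.unop.unop := by
  obtain ⟨x, rfl⟩ := QuotientAddGroup.mk_surjective (Multiplicative.toAdd x)
  exact x.2

lemma truncInclusion_injective (S : c.Truncation) (hS : ∀ p, p ∈ S.1)
    (B : (CommAlgCat.{v} R)ᵒᵖᵒᵖ) : Function.Injective ((truncInclusion α S hS).app B) := by
  intro x y h
  obtain ⟨x, rfl⟩ := QuotientAddGroup.mk_surjective (Multiplicative.toAdd x)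
  obtain ⟨y, rfl⟩ := QuotientAddGroup.mk_surjective (Multiplicative.toAdd y)
  exact congrArg QuotientAddGroup.mk (Subtype.ext h)

/-- The system of truncated kernels, as group objects. -/
noncomputable def kernelDiagram (hα : IsPowerKernel (c := c) α δ) :
    (c.Truncation)ᵒᵖ ⥤ Grp (CommAlgCat.{v} R)ᵒᵖ :=
  grpDiagram (truncPresheaf α) (truncRepresentableBy hα)

variable {d : Coordinates G τ}

/-- The equalizer condition, read on `T`-valued points through the two representations. -/
lemma comp_groupHom_eq_zero_iff {T : (CommAlgCat.{v} R)ᵒᵖ} (f : T ⟶ c.groupObj.X) :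
    f ≫ (c.groupHom d α).hom.hom = f ≫ (0 : c.groupObj ⟶ d.groupObj).hom.hom ↔
      Multiplicative.toAdd (c.representableBy.homEquiv f) ∈ pointKernel α T.unop := by
  have h1 := homEquiv_comp_grpHomOfRepresentableBy c.representableBy d.representableBy
    (Functor.whiskerLeft (unopUnop _) (Functor.whiskerRight α addGroupFunctor)) f
  have h2 := homEquiv_comp_zero d.representableBy c.groupObj f
  exact d.representableBy.homEquiv.apply_eq_iff_eq.symm.trans ((Eq.congr h1 h2).trans Iff.rfl)

/-- The inclusion of the kernel of the homomorphism of group objects induced by `α`. -/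
noncomputable def kernelInclusion (hα : IsPowerKernel (c := c) α δ) (S : c.Truncation)
    (hS : ∀ p, p ∈ S.1) : (kernelDiagram hα).obj (op S) ⟶ c.groupObj :=
  grpHomOfRepresentableBy (truncRepresentableBy hα (op S)) c.representableBy
    (truncInclusion α S hS)

lemma homEquiv_comp_kernelInclusion (hα : IsPowerKernel (c := c) α δ) (S : c.Truncation)
    (hS : ∀ p, p ∈ S.1) {T : (CommAlgCat.{v} R)ᵒᵖ} (f : T ⟶ ((kernelDiagram hα).obj (op S)).X) :
    c.representableBy.homEquiv (f ≫ (kernelInclusion hα S hS).hom.hom) =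
      (truncInclusion α S hS).app (op T) ((truncRepresentableBy hα (op S)).homEquiv f) :=
  homEquiv_comp_grpHomOfRepresentableBy (truncRepresentableBy hα (op S)) c.representableBy
    (truncInclusion α S hS) f

lemma kernelInclusion_condition (hα : IsPowerKernel (c := c) α δ) (S : c.Truncation)
    (hS : ∀ p, p ∈ S.1) :
    (kernelInclusion hα S hS).hom.hom ≫ (c.groupHom d α).hom.hom =
      (kernelInclusion hα S hS).hom.hom ≫ (0 : c.groupObj ⟶ d.groupObj).hom.hom := by
  refine (comp_groupHom_eq_zero_iff _).2 ?_
  have h := homEquiv_comp_kernelInclusion hα S hS (𝟙 _)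
  replace h := (congrArg _ (Category.id_comp (kernelInclusion hα S hS).hom.hom)).symm.trans h
  exact (congrArg (fun y => Multiplicative.toAdd y ∈ pointKernel α _) h).mpr
    (truncInclusion_mem S hS _ _)

/-- The underlying fork of `kernelInclusion` is an equalizer. -/
noncomputable def isLimitKernelInclusion (hα : IsPowerKernel (c := c) α δ) (S : c.Truncation)
    (hS : ∀ p, p ∈ S.1) :
    IsLimit (Fork.ofι _ (kernelInclusion_condition (d := d) hα S hS)) := by
  have key : ∀ s : Fork (c.groupHom d α).hom.hom (0 : c.groupObj ⟶ d.groupObj).hom.hom,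
      ∃ f : s.pt ⟶ ((kernelDiagram hα).obj (op S)).X,
        f ≫ (kernelInclusion hα S hS).hom.hom = s.ι := fun s => by
    obtain ⟨x, hx⟩ := exists_truncInclusion_eq (α := α) S hS (op s.pt) _
      ((comp_groupHom_eq_zero_iff s.ι).1 s.condition)
    refine ⟨(truncRepresentableBy hα (op S)).homEquiv.symm x, ?_⟩
    apply c.representableBy.homEquiv.injective
    refine (homEquiv_comp_kernelInclusion hα S hS _).trans ?_
    exact (congrArg _ ((truncRepresentableBy hα (op S)).homEquiv.apply_symm_apply x)).trans hx
  refine Fork.IsLimit.mk _ (fun s => (key s).choose) (fun s => (key s).choose_spec)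
    fun s m hm => ?_
  apply (truncRepresentableBy hα (op S)).homEquiv.injective
  apply truncInclusion_injective S hS
  refine (homEquiv_comp_kernelInclusion hα S hS m).symm.trans ?_
  refine Eq.trans ?_ (homEquiv_comp_kernelInclusion hα S hS (key s).choose)
  exact congrArg _ (hm.trans (key s).choose_spec.symm)

end Coordinates

end PowerKernels

/-! ### Passage of kernels to group schemes. -/

section Limits

open CategoryTheory Limits Opposite AlgebraicGeometry

universe v

/-- The parallel morphism `z` is kept general because the image of a zero morphism under a functor
is zero only by a proved equality. -/
lemma exists_isLimit_kernelFork {C : Type*} [Category C] [HasZeroMorphisms C] {X Y Z : C}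
    {f z : Y ⟶ Z} {ι : X ⟶ Y} (w : ι ≫ f = ι ≫ z) (hz : z = 0) (h : IsLimit (Fork.ofι ι w)) :
    ∃ w', Nonempty (IsLimit (KernelFork.ofι (f := f) ι w')) := by
  subst hz
  exact ⟨w.trans comp_zero, ⟨h⟩⟩

/-- The functor from affine group schemes to group schemes preserves kernels. -/
theorem exists_isLimit_map_kernelFork {R : CommRingCat.{v}} {G H K : Grp (CommAlgCat.{v} R)ᵒᵖ}
    (u : G ⟶ H) (ι : K ⟶ G) (w : ι.hom.hom ≫ u.hom.hom = ι.hom.hom ≫ (0 : G ⟶ H).hom.hom)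
    (hι : IsLimit (Fork.ofι ι.hom.hom w)) :
    ∃ w', Nonempty (IsLimit (KernelFork.ofι (f := (groupSchemeFunctor R).map u)
      ((groupSchemeFunctor R).map ι) w')) := by
  have h0 : (groupSchemeFunctor R).map (0 : G ⟶ H) = 0 := by
    -- A full functor between categories with zero morphisms preserves them.
    have : (groupSchemeFunctor R).Full := inferInstanceAs (algSpec R).mapGrp.Full
    exact Functor.map_zero _ _ _
  have w1 : ι ≫ u = ι ≫ 0 := Grp.hom_ext _ _ w
  have w2 : (groupSchemeFunctor R).map ι ≫ (groupSchemeFunctor R).map u =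
      (groupSchemeFunctor R).map ι ≫ (groupSchemeFunctor R).map 0 := by
    rw [← Functor.map_comp, w1, Functor.map_comp]
  refine exists_isLimit_kernelFork w2 h0 (isLimitOfIsLimitForkMap (Grp.forget _) w2 ?_)
  exact isLimitForkMapOfIsLimit (algSpec R) w hι

end Limits

end RamWitt

namespace RamWitt

/-! ### The kernel as a limit of its truncations. -/

section PowerKernels

open CategoryTheory Limits Opposite

universe v

variable {R : Type v} [CommRing R] {F G : CommAlgCat.{v} R ⥤ CommRingCat.{v}} {σ τ : Type}

namespace Coordinates

variable {c : Coordinates F σ} {α : F ⟶ G} {δ : σ → ℕ} (hα : IsPowerKernel (c := c) α δ)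

/-- The coordinates of a point of a truncated kernel. -/
noncomputable def pointCoord {S : (c.Truncation)ᵒᵖ} {T : (CommAlgCat.{v} R)ᵒᵖ}
    (f : T ⟶ ((kernelDiagram hα).obj S).X) (p : σ) : T.unop :=
  DFunLike.coe (F := PowerQuotient R (truncExponent δ S.unop.1) →ₐ[R] T.unop) f.unop.hom
    (PowerQuotient.x R (truncExponent δ S.unop.1) p)

variable {hα}

lemma pointCoord_ext {S : (c.Truncation)ᵒᵖ} {T : (CommAlgCat.{v} R)ᵒᵖ}
    {f g : T ⟶ ((kernelDiagram hα).obj S).X}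
    (h : ∀ p ∈ S.unop.1, pointCoord hα f p = pointCoord hα g p) : f = g := by
  apply (truncRepresentableBy hα S).homEquiv.injective
  refine truncCoord_ext (S := S.unop) (B := T.unop) α fun p hp => ?_
  exact (truncCoord_homEquiv hα S f p).trans ((h p hp).trans (truncCoord_homEquiv hα S g p).symm)

lemma pointCoord_comp_map {S S' : (c.Truncation)ᵒᵖ} {T : (CommAlgCat.{v} R)ᵒᵖ}
    (f : T ⟶ ((kernelDiagram hα).obj S).X) (g : S ⟶ S') {p : σ} (hp : p ∈ S'.unop.1) :
    pointCoord hα (f ≫ ((kernelDiagram hα).map g).hom.hom) p = pointCoord hα f p := by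
  refine (truncCoord_homEquiv hα S' _ p).symm.trans ?_
  refine Eq.trans ?_ (truncCoord_homEquiv hα S f p)
  refine (congrArg (fun y => truncCoord α S'.unop T.unop (Multiplicative.toAdd y) p)
    (homEquiv_comp_grpHomOfRepresentableBy (truncRepresentableBy hα S) (truncRepresentableBy hα S')
      ((truncPresheaf α).map g) f)).trans ?_
  exact truncCoord_truncMap α (leOfHom g.unop) (𝟙 T.unop) _ hp

lemma pointCoord_pow {S : (c.Truncation)ᵒᵖ} {T : (CommAlgCat.{v} R)ᵒᵖ}
    (f : T ⟶ ((kernelDiagram hα).obj S).X) {p : σ} (hp : p ∈ S.unop.1) :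
    pointCoord hα f p ^ δ p = 0 := by
  have h := PowerQuotient.x_pow (R := R) (truncExponent δ S.unop.1) p
  rw [truncExponent, if_pos hp] at h
  exact (map_pow f.unop.hom _ _).symm.trans ((congrArg f.unop.hom h).trans (map_zero _))

lemma exists_pointCoord_eq {S : (c.Truncation)ᵒᵖ} (hS : ∀ p, p ∈ S.unop.1)
    {T : (CommAlgCat.{v} R)ᵒᵖ} (b : σ → T.unop) (hb : ∀ p, b p ^ δ p = 0) :
    ∃ f : T ⟶ ((kernelDiagram hα).obj S).X, pointCoord hα f = b := by
  have hb' : ∀ p, b p ^ truncExponent δ S.unop.1 p = 0 := fun p => by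
    rw [truncExponent, if_pos (hS p), hb]
  exact ⟨(CommAlgCat.ofHom (PowerQuotient.lift b hb')).op,
    funext fun p => PowerQuotient.lift_x _ b hb' p⟩

variable (𝒮 : ULift.{v} ℕ →o c.Truncation) (S : c.Truncation)
  (hS : ∀ p, p ∈ S.1)

variable (hα) in
/-- A sequence of truncated kernels. -/
noncomputable abbrev kernelSequence : (ULift.{v} ℕ)ᵒᵖ ⥤ Grp (CommAlgCat.{v} R)ᵒᵖ :=
  𝒮.monotone.functor.op ⋙ kernelDiagram hα

variable (hα) in
/-- The projections of the kernel to a sequence of truncated kernels. -/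
noncomputable def kernelCone : Cone (kernelSequence hα 𝒮) where
  pt := (kernelDiagram hα).obj (op S)
  π :=
    { app n := (kernelDiagram hα).map (homOfLE (fun p _ => hS p : 𝒮 n.unop ≤ S)).op
      naturality m n f := by
        change 𝟙 _ ≫ _ = _ ≫ (kernelDiagram hα).map _
        rw [Category.id_comp, ← Functor.map_comp]
        rfl }

/-- The kernel is the limit of the truncated kernels. -/
noncomputable def isLimitForgetKernelCone (h𝒮 : ∀ p, ∃ n, p ∈ (𝒮 n).1) :
    IsLimit ((Grp.forget _).mapCone (kernelCone hα 𝒮 S hS)) := by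
  have hw : ∀ (s : Cone (kernelSequence hα 𝒮 ⋙ Grp.forget _)) (m n : ULift.{v} ℕ) (p : σ),
      p ∈ (𝒮 m).1 → p ∈ (𝒮 n).1 → pointCoord hα (S := op (𝒮 m)) (s.π.app (op m)) p =
        pointCoord hα (S := op (𝒮 n)) (s.π.app (op n)) p := by
    have hle : ∀ (s : Cone (kernelSequence hα 𝒮 ⋙ Grp.forget _)) (m n : ULift.{v} ℕ) (p : σ),
        m ≤ n → p ∈ (𝒮 m).1 → pointCoord hα (S := op (𝒮 m)) (s.π.app (op m)) p =
          pointCoord hα (S := op (𝒮 n)) (s.π.app (op n)) p := by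
      intro s m n p h hp
      rw [← s.w (homOfLE h).op]
      exact pointCoord_comp_map (s.π.app (op n)) (homOfLE (𝒮.monotone h)).op hp
    intro s m n p hm hn
    rcases le_total m n with h | h
    · exact hle s m n p h hm
    · exact (hle s n m p h hn).symm
  have key : ∀ s : Cone (kernelSequence hα 𝒮 ⋙ Grp.forget _),
      ∃ f : s.pt ⟶ ((kernelDiagram hα).obj (op S)).X, ∀ n p, p ∈ (𝒮 n).1 →
        pointCoord hα f p = pointCoord hα (S := op (𝒮 n)) (s.π.app (op n)) p := by
    intro s
    -- Take coordinate `p` from any level that contains it; by `hw` the choice does not matter.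
    obtain ⟨f, hf⟩ := exists_pointCoord_eq (hα := hα) (S := op S) hS
      (fun p => pointCoord hα (S := op (𝒮 (h𝒮 p).choose)) (s.π.app (op (h𝒮 p).choose)) p)
      fun p => pointCoord_pow (S := op (𝒮 (h𝒮 p).choose)) _ (h𝒮 p).choose_spec
    exact ⟨f, fun n p hp => (congrFun hf p).trans (hw s _ n p (h𝒮 p).choose_spec hp)⟩
  refine
    { lift s := (key s).choose
      fac s n := ?_
      uniq s m hm := ?_ }
  · refine pointCoord_ext (hα := hα) (S := op (𝒮 n.unop)) fun p hp => ?_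
    exact (pointCoord_comp_map _ _ hp).trans ((key s).choose_spec n.unop p hp)
  · refine pointCoord_ext (hα := hα) (S := op S) fun p _ => ?_
    obtain ⟨n, hn⟩ := h𝒮 p
    rw [(key s).choose_spec n p hn]
    refine (pointCoord_comp_map (hα := hα) (S' := op (𝒮 n)) m
      (homOfLE (fun p _ => hS p : 𝒮 n ≤ S)).op hn).symm.trans ?_
    exact congrArg (fun f => pointCoord hα (S := op (𝒮 n)) f p) (hm (op n))

end Coordinates

end PowerKernels

/-! ### Passage of limits to group schemes. -/

section Limits

open CategoryTheory Limits Opposite AlgebraicGeometry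

universe v

/-- The functor from affine group schemes to group schemes preserves limits. -/
theorem nonempty_isLimit_map_cone {R : CommRingCat.{v}} {J : Type v} [SmallCategory J]
    {K : J ⥤ Grp (CommAlgCat.{v} R)ᵒᵖ} {s : Cone K} (hs : IsLimit ((Grp.forget _).mapCone s)) :
    Nonempty (IsLimit ((groupSchemeFunctor R).mapCone s)) := by
  have h1 : IsLimit ((Grp.forget _).mapCone ((groupSchemeFunctor R).mapCone s)) :=
    isLimitOfPreserves (algSpec R) hs
  have := reflectsLimitsOfShape_forget (C := Over (Spec R)) J
  exact ⟨isLimitOfReflects (Grp.forget _) h1⟩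

end Limits

end RamWitt

namespace RamWitt

/-! ### The rings `k[X_p] / (X_p ^ δ_p)`. -/

namespace Coordinates.PowerQuotient

universe v

variable {k : Type v} [Field k] {σ : Type} {δ : σ → ℕ}

lemma induction {M : PowerQuotient k δ → Prop} (hC : ∀ a, M (algebraMap k _ a))
    (hadd : ∀ f g, M f → M g → M (f + g)) (hmul : ∀ f p, M f → M (f * x k δ p))
    (f : PowerQuotient k δ) : M f := by
  obtain ⟨f, rfl⟩ := Ideal.Quotient.mk_surjective f
  induction f using MvPolynomial.induction_on with
  | C a => exact hC a
  | add f g hf hg => rw [map_add]; exact hadd _ _ hf hg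
  | mul_X f p hf => rw [map_mul]; exact hmul _ p hf

/-- The variables outside `S` are zero, and the finitely many others are nilpotent, hence integral.
-/
theorem finite (hδ : ∀ p, 0 < δ p) {S : Set σ} (hS : S.Finite) (hδS : ∀ p ∉ S, δ p = 1) :
    Module.Finite k (PowerQuotient k δ) := by
  have h : Algebra.adjoin k (x k δ '' S) = ⊤ := by
    rw [eq_top_iff]
    rintro f -
    induction f using induction with
    | hC a => exact Subalgebra.algebraMap_mem _ a
    | hadd f g hf hg => exact add_mem hf hg
    | hmul f p hf =>
      refine mul_mem hf ?_
      by_cases hp : p ∈ S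
      · exact Algebra.subset_adjoin ⟨p, hp, rfl⟩
      · have := x_pow (R := k) δ p
        rw [hδS p hp, pow_one] at this
        rw [this]
        exact zero_mem _
  have hf := fg_adjoin_of_finite (R := k) (hS.image (x k δ)) (by
    rintro _ ⟨p, -, rfl⟩
    refine IsIntegral.of_pow (hδ p) ?_
    rw [x_pow]
    exact isIntegral_zero)
  rw [h] at hf
  exact ⟨hf⟩

/-- The augmentation sending all variables to `0` has a nil kernel, so this maximal ideal is
contained in every prime and is therefore the only one. -/
theorem subsingleton_primeSpectrum (hδ : ∀ p, 0 < δ p) :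
    Subsingleton (PrimeSpectrum (PowerQuotient k δ)) := by
  let ε : PowerQuotient k δ →ₐ[k] k := lift 0 fun p => zero_pow (hδ p).ne'
  have key : ∀ f, f - algebraMap k _ (ε f) ∈ nilradical (PowerQuotient k δ) := by
    intro f
    induction f using induction with
    | hC a => simp
    | hadd f g hf hg => rw [map_add, map_add, add_sub_add_comm]; exact add_mem hf hg
    | hmul f p hf =>
      have h0 : ε (x k δ p) = 0 := lift_x _ _ _ p
      rw [map_mul, h0, mul_zero, map_zero, sub_zero]
      exact Ideal.mul_mem_left _ _ ⟨δ p, x_pow δ p⟩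
  have hmax : (RingHom.ker ε).IsMaximal := RingHom.ker_isMaximal_of_surjective ε fun a =>
    ⟨algebraMap k _ a, ε.commutes a⟩
  have heq : ∀ P : PrimeSpectrum (PowerQuotient k δ), RingHom.ker ε = P.asIdeal := fun P =>
    hmax.eq_of_le P.2.ne_top fun f hf => by
      have := key f
      rw [(RingHom.mem_ker).1 hf, map_zero, sub_zero] at this
      exact nilradical_le_prime P.asIdeal this
  exact ⟨fun P Q => PrimeSpectrum.ext ((heq P).symm.trans (heq Q))⟩

end Coordinates.PowerQuotient

/-! ### A criterion for universal homeomorphisms. -/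

section UniversalHomeomorphism

open CategoryTheory AlgebraicGeometry

universe v

/-- All three properties are stable under base change, and an integral morphism is closed; a
continuous closed bijection is a homeomorphism. -/
theorem isUniversalHomeomorphism_of_isIntegralHom {X Y : Scheme.{v}} (f : X ⟶ Y) [IsIntegralHom f]
    [Surjective f] [UniversallyInjective f] : IsUniversalHomeomorphism f := by
  intro X' Y' i₁ i₂ f' h
  have h1 : IsIntegralHom f' := MorphismProperty.of_isPullback h.flip inferInstance
  have h2 : Surjective f' := MorphismProperty.of_isPullback h.flip inferInstance
  have h3 : UniversallyInjective f' := MorphismProperty.of_isPullback h.flip inferInstance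
  exact isHomeomorph_iff_continuous_isClosedMap_bijective.2
    ⟨f'.continuous, f'.isClosedMap, f'.injective, f'.surjective⟩

/-- In a field of characteristic `p` there is at most one `p ^ n`-th root, so the values on powers
in the range of `θ` determine the values on the variables. -/
lemma ringHom_eq_of_comp_eq {k : Type v} [Field k] (p : ℕ) [hp : Fact p.Prime]
    [CharP k p] {σ τ : Type} (θ : MvPolynomial τ k →ₐ[k] MvPolynomial σ k)
    (hX : ∀ s, ∃ n, MvPolynomial.X s ^ p ^ n ∈ θ.range) {K : Type*} [Field K]
    {g₁ g₂ : MvPolynomial σ k →+* K} (h : ∀ f, g₁ (θ f) = g₂ (θ f)) : g₁ = g₂ := by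
  have : CharP K p := charP_of_injective_ringHom (g₁.comp MvPolynomial.C).injective p
  refine MvPolynomial.ringHom_ext (fun a => by simpa using h (MvPolynomial.C a)) fun s => ?_
  obtain ⟨n, g, hg⟩ := hX s
  have hg : θ g = MvPolynomial.X s ^ p ^ n := hg
  have := h g
  rw [hg, map_pow, map_pow, ← sub_eq_zero, ← sub_pow_char_pow] at this
  exact sub_eq_zero.1 ((pow_eq_zero_iff (pow_ne_zero n hp.out.ne_zero)).1 this)

theorem isUniversalHomeomorphism_Spec_map {k : Type v} [Field k] (p : ℕ) [hp : Fact p.Prime]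
    [CharP k p] {σ τ : Type} (θ : MvPolynomial τ k →ₐ[k] MvPolynomial σ k)
    (hθ : Function.Injective θ) (hX : ∀ s, ∃ n, MvPolynomial.X s ^ p ^ n ∈ θ.range) :
    IsUniversalHomeomorphism (Spec.map (CommRingCat.ofHom θ.toRingHom)) := by
  have hint : θ.toRingHom.IsIntegral := by
    let _ := θ.toRingHom.toAlgebra
    intro f
    change IsIntegral (MvPolynomial τ k) f
    induction f using MvPolynomial.induction_on with
    | C a => exact (θ.commutes a) ▸ isIntegral_algebraMap (R := MvPolynomial τ k) (x := MvPolynomial.C a)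
    | add f g hf hg => exact hf.add hg
    | mul_X f s hf =>
      refine hf.mul ?_
      obtain ⟨n, g, hg⟩ := hX s
      refine IsIntegral.of_pow (pow_pos hp.out.pos n) ?_
      rw [← hg]
      exact isIntegral_algebraMap (R := MvPolynomial τ k) (x := g)
  have h1 : IsIntegralHom (Spec.map (CommRingCat.ofHom θ.toRingHom)) :=
    IsIntegralHom.SpecMap_iff.2 hint
  have h2 : Surjective (Spec.map (CommRingCat.ofHom θ.toRingHom)) :=
    ⟨hint.comap_surjective hθ⟩
  have h3 : UniversallyInjective (Spec.map (CommRingCat.ofHom θ.toRingHom)) := by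
    -- Universal injectivity is injectivity on `K`-valued points for all fields `K`.
    have key : ∀ (K : Type v) [Field K], Function.Injective (fun g : Spec (.of K) ⟶ _ =>
        g ≫ Spec.map (CommRingCat.ofHom θ.toRingHom)) := fun K _ g₁ g₂ h => by
      obtain ⟨g₁, rfl⟩ := Spec.map_surjective g₁
      obtain ⟨g₂, rfl⟩ := Spec.map_surjective g₂
      simp only [← Spec.map_comp] at h
      have h := Spec.map_injective h
      congr 1
      exact CommRingCat.hom_ext (ringHom_eq_of_comp_eq p θ hX fun f => congrArg (fun φ => φ.hom f) h)
    exact ((tfae_universallyInjective _).out 0 1).2 key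
  exact isUniversalHomeomorphism_of_isIntegralHom _

end UniversalHomeomorphism

end RamWitt

namespace RamWitt

open MvPolynomial IsLocalRing CategoryTheory Opposite RamifiedWitt
open scoped TensorProduct

universe w v u

variable {O : Type u} [CommRing O] [IsDomain O] [IsDiscreteValuationRing O]
  [Finite (ResidueField O)] {O' : Type v} [CommRing O'] [IsDomain O'] [IsDiscreteValuationRing O']
  [Finite (ResidueField O')]

/-! ### Application to the special fibres. -/

section ComponentSum

variable {B C : Type w} [CommRing B] [Algebra (ResidueField O') B] [CommRing C]
  [Algebra (ResidueField O') C] (η : O'ˣ) (e : ℕ) (ϖ : Uniformizer O')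

/-- The Witt components of the sum `∑_j η ^ ⌊j / e⌋ V ^ j [c_j]`, for algebras over the residue
field. -/
noncomputable def componentSum (c : ℕ → B) : ℕ → B :=
  letI := Algebra.compHom B (algebraMap O' (ResidueField O'))
  sumCoeff η e ϖ c

lemma componentSum_injective : Function.Injective (componentSum (B := B) η e ϖ) :=
  letI := Algebra.compHom B (algebraMap O' (ResidueField O'))
  sumCoeff_injective η e

lemma componentSum_surjective : Function.Surjective (componentSum (B := B) η e ϖ) :=
  letI := Algebra.compHom B (algebraMap O' (ResidueField O'))
  sumCoeff_surjective η e

lemma componentSum_zero : componentSum (B := B) η e ϖ 0 = 0 :=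
  letI := Algebra.compHom B (algebraMap O' (ResidueField O'))
  sumCoeff_zero η e

lemma map_componentSum (φ : B →ₐ[ResidueField O'] C) (c : ℕ → B) (m : ℕ) :
    φ (componentSum η e ϖ c m) = componentSum η e ϖ (fun j => φ (c j)) m :=
  letI := Algebra.compHom B (algebraMap O' (ResidueField O'))
  letI := Algebra.compHom C (algebraMap O' (ResidueField O'))
  map_sumCoeff η e ({ φ with commutes' := fun _ => φ.commutes _ } : B →ₐ[O'] C) c m

end ComponentSum

variable [Algebra O O'] [Module.Finite O O'] [FaithfulSMul O O']

section TensorEquiv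

variable (h : IsTotallyRamified O O') (π : Uniformizer O) (ϖ : Uniformizer O') {e : ℕ}
  (he : Module.finrank O O' = e) {B : Type w} [CommRing B] [Algebra O B]

lemma tensorEquiv_symm_sub (x y : RamifiedWitt π B ⊗[O] O') (i : Fin e) :
    (tensorEquiv h π ϖ he B).symm (x - y) i =
      (tensorEquiv h π ϖ he B).symm x i - (tensorEquiv h π ϖ he B).symm y i := by
  have hs : tensorEquiv h π ϖ he B ((tensorEquiv h π ϖ he B).symm x -
      (tensorEquiv h π ϖ he B).symm y) = x - y := by
    conv_rhs => rw [← (tensorEquiv h π ϖ he B).apply_symm_apply x,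
      ← (tensorEquiv h π ϖ he B).apply_symm_apply y]
    simp only [tensorEquiv, Equiv.ofBijective_apply, Pi.sub_apply, TensorProduct.sub_tmul,
      Finset.sum_sub_distrib]
  rw [← hs, Equiv.symm_apply_apply, Pi.sub_apply]

lemma coeff_tensorEquiv_symm_sub_eq_zero_iff (x y : RamifiedWitt π B ⊗[O] O') (i : Fin e) (N : ℕ) :
    (∀ n < N, ((tensorEquiv h π ϖ he B).symm (x - y) i).coeff n = 0) ↔
      ∀ n < N, ((tensorEquiv h π ϖ he B).symm x i).coeff n =
        ((tensorEquiv h π ϖ he B).symm y i).coeff n := by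
  rw [tensorEquiv_symm_sub, coeff_sub_eq_zero_iff]

theorem coeff_drinfeldTensor [Algebra O' B] [IsScalarTower O O' B] (η : O'ˣ)
    (hη : algebraMap O O' π.1 = η * ϖ.1 ^ e) (hB : algebraMap O' B ϖ.1 = 0)
    (x : RamifiedWitt π B ⊗[O] O') (c : ℕ → B)
    (hc : ∀ n (i : Fin e), c (n * e + i) =
      ((tensorEquiv h π ϖ he B).symm x i).coeff n ^ frobeniusPower O (n, i)) :
    (drinfeldTensor π ϖ B x).coeff = sumCoeff η e ϖ c := by
  funext m
  rw [← coeff_sum_drinfeld_mul ϖ h η (finrank_pos_of_finite he) hη hB _ c hc]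
  conv_lhs => rw [← (tensorEquiv h π ϖ he B).apply_symm_apply x]
  simp only [tensorEquiv, Equiv.ofBijective_apply, map_sum, drinfeldTensor_tmul, Algebra.smul_def,
    map_pow, mul_comm]

end TensorEquiv

variable (h : IsTotallyRamified O O') (π : Uniformizer O) (ϖ : Uniformizer O') {e : ℕ}
  (he : Module.finrank O O' = e)

/-- The Frobenius powers of the coordinates, in the order of the Witt components of `W_{O'}`. -/
noncomputable def frobeniusPowers [NeZero e] (O : Type*) [CommRing O] [IsLocalRing O] {B : Type*}
    [Monoid B] (b : ℕ × Fin e → B) (j : ℕ) : B :=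
  b (Nat.divModEquiv e j) ^ frobeniusPower O (Nat.divModEquiv e j)

lemma frobeniusPowers_apply [NeZero e] {B : Type*} [Monoid B] (b : ℕ × Fin e → B) (n : ℕ)
    (i : Fin e) : frobeniusPowers O b (n * e + i) = b (n, i) ^ frobeniusPower O (n, i) := by
  have : Nat.divModEquiv e (n * e + i) = (n, i) := (Nat.divModEquiv e).apply_symm_apply (n, i)
  rw [frobeniusPowers, this]

/-- The morphism induced by `u ⊗ id` on algebras over the residue field. -/
noncomputable abbrev uRaResidue :=
  Functor.whiskerLeft (restrictAlg O' (ResidueField O')) (uRa (O' := O') π ϖ)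

/-- The factorisation behind both main assertions: powers of the coordinates, reindexed by `j = n e
+ i`, followed by a triangular bijection. It applies because `ϖ` is zero in algebras over the
residue field. -/
theorem wittCoordinates_uRa [NeZero e] (η : O'ˣ) (hη : algebraMap O O' π.1 = η * ϖ.1 ^ e)
    (B : CommAlgCat.{v} (ResidueField O'))
    (x : (restrictAlg O' (ResidueField O') ⋙ wittTensorFunctor O' π).obj B) :
    (wittCoordinates ϖ (ResidueField O')).equiv B ((uRaResidue π ϖ).app B x) =
      componentSum η e ϖ (frobeniusPowers O
        ((wittTensorCoordinates h π ϖ he (ResidueField O')).equiv B x)) := by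
  let _ := Algebra.compHom B (algebraMap O' (ResidueField O'))
  let _ := Algebra.compHom B (algebraMap O O')
  have : IsScalarTower O O' B := .of_algebraMap_eq fun _ => rfl
  have hB : algebraMap O' B ϖ.1 = 0 := by
    change algebraMap (ResidueField O') B (residue O' ϖ.1) = 0
    rw [(ϖ.dvd_iff ϖ.1).1 dvd_rfl, map_zero]
  exact (fun x : RamifiedWitt π B ⊗[O] O' => coeff_drinfeldTensor h π ϖ he η hη hB x
    (frobeniusPowers O fun p => ((tensorEquiv h π ϖ he B).symm x p.2).coeff p.1)
    fun n i => frobeniusPowers_apply _ n i) x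

/-- The triangular bijection is injective and fixes `0`, so the image vanishes exactly when all the
powers do. -/
theorem isPowerKernel_uRa : Coordinates.IsPowerKernel
    (c := wittTensorCoordinates h π ϖ he (ResidueField O')) (uRaResidue π ϖ)
    (frobeniusPower O (e := e)) where
  pos p := pow_pos residueCard_pos _
  zero_iff B x := by
    have : NeZero e := ⟨(finrank_pos_of_finite he).ne'⟩
    obtain ⟨η, hη⟩ := h.exists_unit_mul_pow π.2 ϖ.2 he
    have h0 : (wittCoordinates ϖ (ResidueField O')).equiv B 0 = 0 := by
      let _ := Algebra.compHom B (algebraMap O' (ResidueField O'))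
      exact funext fun n => coeff_zero_eq (π := ϖ) n
    rw [← ((wittCoordinates ϖ (ResidueField O')).equiv B).apply_eq_iff_eq,
      wittCoordinates_uRa h π ϖ he η hη, h0, ← componentSum_zero η e ϖ,
      (componentSum_injective η e ϖ).eq_iff, funext_iff]
    exact (Nat.divModEquiv e).forall_congr_left.trans (forall_congr' fun p => by
      rw [Pi.zero_apply, frobeniusPowers, Equiv.apply_symm_apply])

/-- Membership of `(n, i)` in `S` brings all components up to `n` into `S`, so the statement reduces
to the truncations of each `b_i` to `n + 1` components. -/
theorem isTruncation_iff (S : Set (ℕ × Fin e))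
    (hS : ∀ n i, (n, i) ∈ S → ∀ m i', m ≤ n → (m, i') ∈ S) :
    (wittTensorCoordinates h π ϖ he (ResidueField O')).IsTruncation S := by
  intro B x y
  let _ := Algebra.compHom B (algebraMap O' (ResidueField O'))
  let _ := Algebra.compHom B (algebraMap O O')
  have key := (coeff_tensorEquiv_symm_sub_eq_zero_iff h π ϖ he (B := B) · ·) x y
  constructor
  · rintro hxy ⟨n, i⟩ hn
    exact (key i (n + 1)).1 (fun m hm => hxy (m, i) (hS n i hn m i (Nat.lt_succ_iff.1 hm))) n
      n.lt_succ_self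
  · rintro hxy ⟨n, i⟩ hn
    exact (key i (n + 1)).2 (fun m hm => hxy (m, i) (hS n i hn m i (Nat.lt_succ_iff.1 hm))) n
      n.lt_succ_self

end RamWitt

namespace RamWitt

open MvPolynomial IsLocalRing CategoryTheory Opposite RamifiedWitt AlgebraicGeometry Limits
open scoped TensorProduct

universe w v u

/-- Yoneda: the homomorphism on rings is read off from the image of the generic point, which
corresponds to the identity. -/
lemma Coordinates.groupHom_hom_X {R : Type v} [CommRing R]
    {F G : CommAlgCat.{v} R ⥤ CommRingCat.{v}} {σ τ : Type} (c : Coordinates F σ)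
    (d : Coordinates G τ) (α : F ⟶ G) :
    ∃ θ : MvPolynomial τ R →ₐ[R] MvPolynomial σ R,
      (c.groupHom d α).hom.hom = (CommAlgCat.ofHom θ).op ∧
      ∀ j, θ (X j) = d.equiv _ (α.app (CommAlgCat.of R (MvPolynomial σ R))
        ((c.equiv (CommAlgCat.of R (MvPolynomial σ R))).symm X)) j := by
  refine ⟨(c.groupHom d α).hom.hom.unop.hom, rfl, fun j => ?_⟩
  have h := homEquiv_comp_grpHomOfRepresentableBy c.representableBy d.representableBy
    (Functor.whiskerLeft (unopUnop _) (Functor.whiskerRight α addGroupFunctor)) (𝟙 _)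
  have h' := congrArg (fun x => d.equiv (CommAlgCat.of R (MvPolynomial σ R))
    (Multiplicative.toAdd x) j) h
  refine Eq.trans ?_ h'
  refine Eq.symm ((congrFun ((d.equiv (CommAlgCat.of R (MvPolynomial σ R))).apply_symm_apply _)
    j).trans ?_)
  rfl

variable {O : Type u} [CommRing O] [IsDomain O] [IsDiscreteValuationRing O]
  [Finite (ResidueField O)] {O' : Type v} [CommRing O'] [IsDomain O'] [IsDiscreteValuationRing O']
  [Finite (ResidueField O')]

/-! ### The homomorphism of polynomial rings, and the three assertions. -/

section PolynomialRings

variable (η : O'ˣ) {e : ℕ} [NeZero e] (ϖ : Uniformizer O')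
  {θ : MvPolynomial ℕ (ResidueField O') →ₐ[ResidueField O']
    MvPolynomial (ℕ × Fin e) (ResidueField O')}

/-- Inverting the triangular change of coordinates over the source ring gives polynomials `c j`
whose component sum is `X`. Their images under `θ` have the same component sum as the powers of the
variables, hence equal them. -/
lemma frobeniusPowers_X_mem_range
    (hθ : (fun j => θ (X j)) = componentSum η e ϖ (frobeniusPowers O X)) (j : ℕ) :
    frobeniusPowers O X j ∈ θ.range := by
  obtain ⟨c, hc⟩ := componentSum_surjective η e ϖ
    (X : ℕ → MvPolynomial ℕ (ResidueField O'))
  have h : (fun j => θ (c j)) = frobeniusPowers O X := by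
    apply componentSum_injective η e ϖ
    rw [← hθ]
    funext m
    rw [← map_componentSum, hc]
  exact ⟨c j, congrFun h j⟩

/-- `θ` is the triangular endomorphism `ψ`, which has a left inverse, followed by the substitution
`ζ` of positive powers of distinct variables, which are algebraically independent. -/
lemma injective_of_componentSum
    (hθ : (fun j => θ (X j)) = componentSum η e ϖ (frobeniusPowers O X)) :
    Function.Injective θ := by
  set ζ : MvPolynomial ℕ (ResidueField O') →ₐ[ResidueField O']
    MvPolynomial (ℕ × Fin e) (ResidueField O') := aeval (frobeniusPowers O X)
  set ψ : MvPolynomial ℕ (ResidueField O') →ₐ[ResidueField O'] MvPolynomial ℕ (ResidueField O') :=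
    aeval (componentSum η e ϖ X)
  have h1 : θ = ζ.comp ψ := by
    refine MvPolynomial.algHom_ext fun m => ?_
    rw [AlgHom.comp_apply, aeval_X, map_componentSum]
    simp only [ζ, aeval_X]
    exact congrFun hθ m
  have hψ : Function.Injective ψ := by
    obtain ⟨c, hc⟩ := componentSum_surjective η e ϖ
      (X : ℕ → MvPolynomial ℕ (ResidueField O'))
    refine Function.LeftInverse.injective (g := aeval c) fun f => ?_
    rw [← AlgHom.comp_apply, ← AlgHom.id_apply (R := ResidueField O') f]
    congr 1
    refine MvPolynomial.algHom_ext fun m => ?_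
    rw [AlgHom.comp_apply, aeval_X, map_componentSum]
    simp only [aeval_X]
    exact congrFun hc m
  have hζ : AlgebraicIndependent (ResidueField O')
      (frobeniusPowers O (X : ℕ × Fin e → MvPolynomial (ℕ × Fin e) (ResidueField O'))) := by
    have := (MvPolynomial.algebraicIndependent_X (ℕ × Fin e)
      (ResidueField O')).polynomial_aeval_of_transcendental
      (f := fun p => Polynomial.X ^ frobeniusPower O p) fun p =>
        (Polynomial.transcendental_X (ResidueField O')).pow (pow_pos residueCard_pos _)
    simp only [map_pow, Polynomial.aeval_X] at this
    exact this.comp _ (Nat.divModEquiv e).injective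
  rw [h1, AlgHom.coe_comp]
  exact (show Function.Injective ζ from hζ).comp hψ

end PolynomialRings

variable [Algebra O O'] [Module.Finite O O'] [FaithfulSMul O O']
  (h : IsTotallyRamified O O') (π : Uniformizer O) (ϖ : Uniformizer O') {e : ℕ}
  (he : Module.finrank O O' = e)

theorem isUniversalHomeomorphism_uRaSpecial :
    IsUniversalHomeomorphism (uRaSpecial h π ϖ he).hom.hom.left := by
  have : NeZero e := ⟨(finrank_pos_of_finite he).ne'⟩
  obtain ⟨η, hη⟩ := h.exists_unit_mul_pow π.2 ϖ.2 he
  obtain ⟨θ, h1, h2⟩ := Coordinates.groupHom_hom_X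
    (wittTensorCoordinates h π ϖ he (ResidueField O')) (wittCoordinates ϖ (ResidueField O'))
    (uRaResidue π ϖ)
  have hθ : (fun j => θ (X j)) = componentSum η e ϖ (frobeniusPowers O X) := by
    funext j
    rw [h2, wittCoordinates_uRa h π ϖ he η hη, Equiv.apply_symm_apply]
  have hu : (uRaSpecial h π ϖ he).hom.hom.left = Spec.map (CommRingCat.ofHom θ.toRingHom) :=
    congrArg (fun f => ((algSpec (residueRing O')).map f).left) h1
  rw [hu]
  cases nonempty_fintype (ResidueField O')
  obtain ⟨p, hp, n, hpp, hn⟩ := FiniteField.card' (ResidueField O')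
  have : Fact p.Prime := ⟨hpp⟩
  refine isUniversalHomeomorphism_Spec_map p θ (injective_of_componentSum (O := O) η ϖ hθ) fun s => ?_
  -- With `q = p ^ n`, the exponent `q ^ r` of a coordinate is `p ^ (n r)`.
  refine ⟨n * (s.1 * (e - 1) + s.2), ?_⟩
  have hs := frobeniusPowers_X_mem_range (O := O) η ϖ hθ ((Nat.divModEquiv e).symm s)
  rwa [frobeniusPowers, Equiv.apply_symm_apply, frobeniusPower, ← residueCard, ← h.residueCard_eq,
    residueCard, Nat.card_eq_fintype_card, hn, ← pow_mul] at hs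

/-- The truncations to the first `N` Witt components. -/
def wittTruncation : ULift.{v} ℕ →o
    (wittTensorCoordinates h π ϖ he (ResidueField O')).Truncation where
  toFun N := ⟨{p | p.1 < N.down}, isTruncation_iff h π ϖ he _ fun _ _ hn _ _ hm => hm.trans_lt hn⟩
  monotone' M N hMN p hp := show p.1 < N.down from lt_of_lt_of_le (show p.1 < M.down from hp) hMN

/-- The truncation that omits no component. -/
def wittUniv : (wittTensorCoordinates h π ϖ he (ResidueField O')).Truncation :=
  ⟨Set.univ, isTruncation_iff h π ϖ he _ fun _ _ _ _ _ _ => trivial⟩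

/-- The kernel of `u ⊗ id` on the special fibres as a group object in the opposite category of
algebras, and its truncations. -/
noncomputable abbrev wittKernel :=
  Coordinates.kernelDiagram (isPowerKernel_uRa h π ϖ he)

/-- The kernel of group schemes is thereby the spectrum of an explicit ring: the equalizer computed
on points stays a kernel under `groupSchemeFunctor`. -/
theorem nonempty_kernel_iso : Nonempty (kernel (uRaSpecial h π ϖ he) ≅
    (groupSchemeFunctor (residueRing O')).obj ((wittKernel h π ϖ he).obj (op (wittUniv h π ϖ he)))) := by
  obtain ⟨w, ⟨hw⟩⟩ := exists_isLimit_map_kernelFork (R := residueRing O') _ _ _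
    (Coordinates.isLimitKernelInclusion (d := wittCoordinates ϖ (ResidueField O'))
      (isPowerKernel_uRa h π ϖ he) (wittUniv h π ϖ he) fun _ => trivial)
  exact ⟨(limit.isLimit _).conePointUniqueUpToIso hw⟩

lemma truncExponent_pos (S : Set (ℕ × Fin e)) (p : ℕ × Fin e) :
    0 < Coordinates.truncExponent (frobeniusPower O) S p := by
  rw [Coordinates.truncExponent]
  split_ifs
  · exact pow_pos residueCard_pos _
  · exact one_pos

lemma isInfinitesimal_wittKernel (N : ULift.{v} ℕ) :
    IsInfinitesimal ((groupSchemeFunctor (residueRing O')).obj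
      ((wittKernel h π ϖ he).obj (op (wittTruncation h π ϖ he N)))) where
  isFinite := by
    have : Module.Finite (ResidueField O') (Coordinates.PowerQuotient (ResidueField O')
        (Coordinates.truncExponent (frobeniusPower O (e := e)) {p | p.1 < N.down})) := by
      refine Coordinates.PowerQuotient.finite (truncExponent_pos _) (S := {p | p.1 < N.down}) ?_
        fun p hp => if_neg hp
      exact ((Set.finite_lt_nat N.down).prod (Set.finite_univ (α := Fin e))).subset
        fun p hp => ⟨hp, trivial⟩
    exact (IsFinite.SpecMap_iff (f := CommRingCat.ofHom (algebraMap (ResidueField O')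
      (Coordinates.PowerQuotient (ResidueField O') (Coordinates.truncExponent
        (frobeniusPower O (e := e)) {p | p.1 < N.down}))))).2 (RingHom.finite_algebraMap.2 this)
  subsingleton := Coordinates.PowerQuotient.subsingleton_primeSpectrum (k := ResidueField O')
    (truncExponent_pos (O := O) (e := e) {p | p.1 < N.down})

theorem isProInfinitesimal_kernel : IsProInfinitesimal (kernel (uRaSpecial h π ϖ he)) := by
  obtain ⟨i⟩ := nonempty_kernel_iso h π ϖ he
  obtain ⟨hl⟩ := nonempty_isLimit_map_cone (R := residueRing O')
    (Coordinates.isLimitForgetKernelCone (hα := isPowerKernel_uRa h π ϖ he)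
      (wittTruncation h π ϖ he) (wittUniv h π ϖ he) (fun _ => trivial)
      fun p => ⟨⟨p.1 + 1⟩, p.1.lt_succ_self⟩)
  let s := (groupSchemeFunctor (residueRing O')).mapCone (Coordinates.kernelCone
    (hα := isPowerKernel_uRa h π ϖ he) (wittTruncation h π ϖ he) (wittUniv h π ϖ he)
      fun _ => trivial)
  exact ⟨(ULift.{v} ℕ)ᵒᵖ, inferInstance, inferInstance, _,
    (Functor.const _).map i.hom ≫ s.π,
    fun j => isInfinitesimal_wittKernel h π ϖ he j.unop,
    ⟨hl.ofIsoLimit (Cone.ext i.symm fun j => (i.inv_hom_id_assoc _).symm)⟩⟩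

theorem nonempty_kernel_X_iso : Nonempty ((kernel (uRaSpecial h π ϖ he)).X ≅
    Over.mk (Spec.map (CommRingCat.ofHom (algebraMap (ResidueField O')
      (Coordinates.PowerQuotient (ResidueField O') (frobeniusPower O (e := e))))))) := by
  obtain ⟨i⟩ := nonempty_kernel_iso h π ϖ he
  have hδ : Coordinates.truncExponent (frobeniusPower O (e := e)) Set.univ = frobeniusPower O :=
    funext fun p => if_pos trivial
  rw [← hδ]
  exact ⟨(Grp.forget _).mapIso i⟩

end RamWitt

theorem mainTheorem5
    {O : Type*} [CommRing O] [IsDomain O] [IsDiscreteValuationRing O]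
    [IsAdicComplete (IsLocalRing.maximalIdeal O) O] [Finite (IsLocalRing.ResidueField O)]
    {O' : Type*} [CommRing O'] [IsDomain O'] [IsDiscreteValuationRing O']
    [Finite (IsLocalRing.ResidueField O')]
    [Algebra O O'] [FaithfulSMul O O'] [Module.Finite O O']
    (h : RamWitt.IsTotallyRamified O O') {e : ℕ} (he : Module.finrank O O' = e)
    (π : RamWitt.Uniformizer O) (ϖ : RamWitt.Uniformizer O') :
    RamWitt.IsUniversalHomeomorphism (RamWitt.uRaSpecial h π ϖ he).hom.hom.left ∧
    RamWitt.IsProInfinitesimal (CategoryTheory.Limits.kernel (RamWitt.uRaSpecial h π ϖ he)) ∧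
    Nonempty ((CategoryTheory.Limits.kernel (RamWitt.uRaSpecial h π ϖ he)).X ≅
      CategoryTheory.Over.mk (AlgebraicGeometry.Spec.map (CommRingCat.ofHom
        (algebraMap (IsLocalRing.ResidueField O')
          (MvPolynomial (ℕ × Fin e) (IsLocalRing.ResidueField O') ⧸
            Ideal.span (Set.range fun p : ℕ × Fin e =>
              (MvPolynomial.X p : MvPolynomial (ℕ × Fin e) (IsLocalRing.ResidueField O')) ^
                RamWitt.residueCard O ^ (p.1 * (e - 1) + p.2))))))) :=
  ⟨RamWitt.isUniversalHomeomorphism_uRaSpecial h π ϖ he,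
    RamWitt.isProInfinitesimal_kernel h π ϖ he, RamWitt.nonempty_kernel_X_iso h π ϖ he⟩
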